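/- **Setting.** Families are indexed by $\varepsilon\in(0,1]$. Let $A$ be a solid subring of $\mathbb R^{(0,1]}$ (if $|s_\varepsilon|\le |r_\varepsilon|$ for all $\varepsilon$ and $(r_\varepsilon)\in A$, then $(s_\varepsilon)\in A$), let $I_A$ be a solid ideal of $A$, $\mathcal C=A/I_A$, $|A|=\{(|r_\varepsilon|)_\varepsilon:(r_\varepsilon)\in A\}$ and likewise $|I_A|$. For $d=1,2$, a compact set $K\subset\mathbb R^d$ and $l\in\mathbb N$ put $P_{K,l}(u)=\sup_{|\alpha|\le l,\,x\in K}|D^\alpha u(x)|$. Let $\mathcal X(\mathbb R^d)$ (moderate families), respectively $\mathcal N(\mathbb R^d)$ (negligible families), be the set of families $(u_\varepsilon)$ in $C^\infty(\mathbb R^d)$ with $(P_{K,l}(u_\varepsilon))_\varepsilon\in|A|$, respectively $\in|I_A|$, for all compact $K$ and all $l$. The generalized algebra is $\mathcal A(\mathbb R^d)=\mathcal X(\mathbb R^d)/\mathcal N(\mathbb R^d)$, and $[u_\varepsilon]$ denotes a class. Partial derivatives act by $\partial[u_\varepsilon]=[\partial u_\varepsilon]$. The ring $\mathcal C$ is *overgenerated*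 by finitely many positive families if $A$ consists exactly of the $(s_\varepsilon)$ such that $|s_\varepsilon|\le b_\varepsilon$ for all sufficiently small $\varepsilon$, for some rational function $b$, with positive coefficients, of these families. $\mathcal A(\mathbb R^2)$ is *stable under* $F$ (relatively to $\mathcal C$) if for every compact $K\subset\mathbb R^2$, $l\in\mathbb N$ and $(u_\varepsilon),(v_\varepsilon)\in\mathcal X(\mathbb R^2)$ there are positive families $(C_{i,\varepsilon})_\varepsilon,(D_{j,\varepsilon})_\varepsilon\in A$ (for instance constants) such that for all $\varepsilon$ $$P_{K,l}(F(\cdot,\cdot,u_\varepsilon))\le\sum_{i=0}^{l}C_{i,\varepsilon}P_{K,l}(u_\varepsilon)^i,\qquad P_{K,l}(F(\cdot,\cdot,v_\varepsilon)-F(\cdot,\cdot,u_\varepsilon))\le\sum_{j=1}^{l}D_{j,\varepsilon}P_{K,l}(v_\varepsilon-u_\varepsilon)^j,$$ the second inequality being required for $l\ge1$ only. Then $\mathcal F([u_\varepsilon])=[F(\cdot,\cdot,u_\varepsilon)]$ is a well defined map of $\mathcal A(\mathbb R^2)$ to itself. A family $(f_\varepsilon)$ is *compatible with restriction* if $(u_\varepsilon)\mapsto(u_\varepsilon(\cdot,f_\varepsilon(\cdot)))$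 maps $\mathcal X(\mathbb R^2)$ into $\mathcal X(\mathbb R)$ and $\mathcal N(\mathbb R^2)$ into $\mathcal N(\mathbb R)$; then $\mathcal R([u_\varepsilon])=[u_\varepsilon(\cdot,f_\varepsilon(\cdot))]$ is a well defined map $\mathcal A(\mathbb R^2)\to\mathcal A(\mathbb R)$. $\mathcal O_M(\mathbb R)$ is the space of $f\in C^\infty(\mathbb R)$ such that for each $m$ there is $q$ with $\sup_{x,\,k\le m}(1+|x|)^{-q}|f^{(k)}(x)|<\infty$. $\mathcal X_\tau(\mathbb R)$ is the set of families in $\mathcal O_M(\mathbb R)$ such that for each $m$ there are $q,N\in\mathbb N$ with $\sup_{x,\,k\le m}(1+|x|)^{-q}|f_\varepsilon^{(k)}(x)|=O(\varepsilon^{-N})$ as $\varepsilon\to0$. For $a,b>0$ put $\beta_\varepsilon=\max(a,f_\varepsilon^{-1}(b))$, $\alpha_\varepsilon=\min(-a,f_\varepsilon^{-1}(-b))$, $w_\varepsilon=2\max(\beta_\varepsilon,|\alpha_\varepsilon|)$ and $$K_\varepsilon(a,b)=[-w_\varepsilon/2,w_\varepsilon/2]\times[-b,b],\qquad L_\varepsilon(a,b)=[\alpha_\varepsilon,\beta_\varepsilon]\times[-b,b].$$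 Thus $[-a,a]\times[-b,b]\subset L_\varepsilon(a,b)\subset K_\varepsilon(a,b)$. **Hypotheses.** * (H) $F\in C^\infty(\mathbb R^3,\mathbb R)$; $\sup_{(x,y)\in K,\,z\in\mathbb R}|\partial_zF(x,y,z)|<\infty$ for each compact $K\subset\mathbb R^2$; each $f_\varepsilon$ is a strictly increasing map of $\mathbb R$ onto $\mathbb R$ with $f_\varepsilon'(x)\ne0$ for all $x$. * (H1) There are positive families $(M_\varepsilon),(a_\varepsilon)$ such that for all $a,b>0$: for every $l\in\mathbb N$ there is $\mu>0$ with $\sup_{K_\varepsilon(a,b)\times\mathbb R,\,|\alpha|\le l}|D^\alpha F|\le\mu M_\varepsilon$ for all $\varepsilon$, and there is $\nu>0$ with $w_\varepsilon\le\nu a_\varepsilon$ for all $\varepsilon$. * (H2) $\chi_\varepsilon$ is a primitive of $\psi\circ f_\varepsilon^{-1}$, and $(r_\varepsilon)$ is a positive family such that for every compact $K_2\subset\mathbb R$ and $n\in\mathbb N$ there are $D_\varepsilon>0$ and $p\in\mathbb N$ with $\max\big(\sup_{K_2}|(\varphi\circ f_\varepsilon^{-1})^{(n)}|,\sup_{K_2}|\chi_\varepsilon^{(n)}|\big)\le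 D_\varepsilon r_\varepsilon^{-p}$ for all $\varepsilon$. * (H3) $\mathcal C$ is overgenerated by $(\varepsilon)$, $(r_\varepsilon)$, $(M_\varepsilon)$, $(\exp(M_\varepsilon a_\varepsilon))$. * (H4) $\mathcal A(\mathbb R^2)$, built on $\mathcal C$, is stable under $F$. * (H5) $f_\varepsilon\in C^\infty(\mathbb R)$ and $\varphi,\psi\in\mathcal O_M(\mathbb R)$. * (H6) $(f_\varepsilon),(f_\varepsilon^{-1})\in\mathcal X_\tau(\mathbb R)$; for each compact $K\subset\mathbb R$ there is a compact $L$ with $f_\varepsilon(K)\subset L$ for all $\varepsilon$; and $f_\varepsilon\to f$ in $\mathcal D'(\mathbb R)$ as $\varepsilon\to0$, for a locally integrable function $f$. **Theorem.** Assume (H), (H1)–(H6), and for each $\varepsilon$ let $u_\varepsilon\in C^\infty(\mathbb R^2)$ be the solution of $$(P_\varepsilon)\qquad \frac{\partial^2u_\varepsilon}{\partial x\partial y}=F(\cdot,\cdot,u_\varepsilon),\qquad u_\varepsilon(x,f_\varepsilon(x))=\varphi(x),\qquad \frac{\partial u_\varepsilon}{\partial y}(x,f_\varepsilon(x))=\psi(x).$$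 Then $(u_\varepsilon)\in\mathcal X(\mathbb R^2)$, and moreover $(P_{L_\varepsilon(a,b),n}(u_\varepsilon))_\varepsilon\in|A|$ for all $a,b>0$ and $n\in\mathbb N$. The family $(f_\varepsilon)$ is compatible with restriction, and $u=[u_\varepsilon]\in\mathcal A(\mathbb R^2)$ solves $$(P_{gen})\qquad \frac{\partial^2u}{\partial x\partial y}=\mathcal F(u),\qquad\mathcal R(u)=[\varphi],\qquad\mathcal R\Big(\frac{\partial u}{\partial y}\Big)=[\psi],$$ where $[\varphi],[\psi]\in\mathcal A(\mathbb R)$ are the classes of the constant families. -/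

import Mathlib

open Set Filter Topology MeasureTheory
open scoped ContDiff

noncomputable section

namespace GenFun

/-! ### The index set and the rings of scales -/

/-- The index set `(0, 1]`. -/
abbrev Idx : Type := Set.Ioc (0 : ℝ) 1

/-- A solid subring `A` of `ℝ^(0,1]` together with a solid ideal `I` of `A`; the ring of
generalized constants is `A / I`. -/
structure Scale where
  A : Subring (Idx → ℝ)
  solidA : ∀ s r : Idx → ℝ, r ∈ A → (∀ ε, |s ε| ≤ |r ε|) → s ∈ A
  I : Ideal A
  solidI : ∀ s r : A, r ∈ I → (∀ ε, |(s : Idx → ℝ) ε| ≤ |(r : Idx → ℝ) ε|) → s ∈ I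

/-- `|A|`. -/
def Scale.absA (C : Scale) : Set (Idx → ℝ) :=
  {s | ∃ r ∈ C.A, s = fun ε => |r ε|}

/-- `|I_A|`. -/
def Scale.absI (C : Scale) : Set (Idx → ℝ) :=
  {s | ∃ r ∈ C.I, s = fun ε => |(r : Idx → ℝ) ε|}

/-- A nonzero polynomial all of whose (nonzero) coefficients are positive. -/
def PosPoly {p : ℕ} (P : MvPolynomial (Fin p) ℝ) : Prop :=
  P ≠ 0 ∧ ∀ m, 0 ≤ P.coeff m

/-- The families obtained as rational functions with positive coefficients of the families
`g 0, …, g (p-1)`. -/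
def ratFamilies {p : ℕ} (g : Fin p → Idx → ℝ) : Set (Idx → ℝ) :=
  {b | ∃ P Q : MvPolynomial (Fin p) ℝ, PosPoly P ∧ PosPoly Q ∧
    ∀ ε, b ε = MvPolynomial.eval (fun i => g i ε) P / MvPolynomial.eval (fun i => g i ε) Q}

/-- The ring of scales is overgenerated by the positive families `g 0, …, g (p-1)`. -/
def Scale.OvergeneratedBy (C : Scale) {p : ℕ} (g : Fin p → Idx → ℝ) : Prop :=
  (∀ i ε, 0 < g i ε) ∧
    ∀ s : Idx → ℝ, s ∈ C.A ↔ ∃ b ∈ ratFamilies g, ∃ ε₀ : Idx, ∀ ε, ε < ε₀ → |s ε| ≤ b ε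

theorem Scale.mem_absA {C : Scale} {s : Idx → ℝ} (hs : ∀ ε, 0 ≤ s ε) :
    s ∈ C.absA ↔ s ∈ C.A := by
  constructor
  · rintro ⟨r, hr, rfl⟩
    exact C.solidA _ r hr (fun ε => by simp)
  · intro h
    exact ⟨s, h, funext fun ε => (abs_of_nonneg (hs ε)).symm⟩

theorem Scale.absA_of_le {C : Scale} {s t : Idx → ℝ} (hs : ∀ ε, 0 ≤ s ε) (ht : t ∈ C.A)
    (h : ∀ ε, s ε ≤ t ε) : s ∈ C.absA :=
  (Scale.mem_absA hs).2 (C.solidA _ t ht fun ε => by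
    rw [abs_of_nonneg (hs ε)]; exact (h ε).trans (le_abs_self _))

theorem Scale.mem_absI {C : Scale} {s : Idx → ℝ} (hs : ∀ ε, 0 ≤ s ε) :
    s ∈ C.absI ↔ ∃ h : s ∈ C.A, (⟨s, h⟩ : C.A) ∈ C.I := by
  constructor
  · rintro ⟨r, hr, rfl⟩
    have h : (fun ε => |(r : Idx → ℝ) ε|) ∈ C.A := C.solidA _ r r.2 (fun ε => by simp)
    exact ⟨h, C.solidI _ r hr (fun ε => by simp)⟩
  · rintro ⟨h, hI⟩
    exact ⟨⟨s, h⟩, hI, funext fun ε => (abs_of_nonneg (hs ε)).symm⟩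

theorem Scale.absI_of_le {C : Scale} {s : Idx → ℝ} {t : C.A} (hs : ∀ ε, 0 ≤ s ε) (ht : t ∈ C.I)
    (h : ∀ ε, s ε ≤ (t : Idx → ℝ) ε) : s ∈ C.absI := by
  have h' : ∀ ε, |s ε| ≤ |(t : Idx → ℝ) ε| := fun ε => by
    rw [abs_of_nonneg (hs ε)]; exact (h ε).trans (le_abs_self _)
  have hA : s ∈ C.A := C.solidA _ t t.2 h'
  exact (Scale.mem_absI hs).2 ⟨hA, C.solidI ⟨s, hA⟩ t ht h'⟩

theorem Scale.const_mem (C : Scale) (c : ℝ) : (fun _ => c : Idx → ℝ) ∈ C.A := by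
  obtain ⟨n, hn⟩ := exists_nat_ge |c|
  refine C.solidA _ ((n : Idx → ℝ)) (natCast_mem C.A n) fun ε => ?_
  simpa using hn

/-! ### Partial derivatives and seminorms

`e : ι → E` lists the coordinate directions of `E`. -/

/-- The coordinate direction of `ℝ`. -/
def e₁ : Fin 1 → ℝ := fun _ => 1

/-- The coordinate directions of `ℝ²`. -/
def e₂ : Fin 2 → ℝ × ℝ := ![(1, 0), (0, 1)]

/-- The coordinate directions of `ℝ³`. -/
def e₃ : Fin 3 → ℝ × ℝ × ℝ := ![(1, 0, 0), (0, 1, 0), (0, 0, 1)]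

variable {ι : Type} {E : Type} [NormedAddCommGroup E] [NormedSpace ℝ E]

/-- The partial derivative of `u` in the `i`-th coordinate direction. -/
def pd (e : ι → E) (i : ι) (u : E → ℝ) : E → ℝ := fun x => fderiv ℝ u x (e i)

/-- Iterated partial derivatives. For smooth functions the order of the letters is immaterial, so
words of length at most `l` describe exactly the `D^α` with `|α| ≤ l`. -/
def pds (e : ι → E) : List ι → (E → ℝ) → (E → ℝ)
  | [], u => u
  | i :: w, u => pd e i (pds e w u)

/-- `P_{K,l}(u)`, the supremum over `x ∈ K` and `|α| ≤ l` of `|D^α u (x)|`. -/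
def seminorm (e : ι → E) (K : Set E) (l : ℕ) (u : E → ℝ) : ℝ :=
  sSup {t | ∃ w : List ι, w.length ≤ l ∧ ∃ x ∈ K, t = |pds e w u x|}

theorem contDiff_pd (e : ι → E) (i : ι) {u : E → ℝ} (hu : ContDiff ℝ ∞ u) :
    ContDiff ℝ ∞ (pd e i u) :=
  (hu.fderiv_right (m := ∞) (by simp)).clm_apply contDiff_const

theorem contDiff_pds (e : ι → E) (w : List ι) {u : E → ℝ} (hu : ContDiff ℝ ∞ u) :
    ContDiff ℝ ∞ (pds e w u) := by
  induction w with
  | nil => exact hu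
  | cons i w ih => exact contDiff_pd e i ih

theorem pd_add (e : ι → E) (i : ι) {u v : E → ℝ} (hu : ContDiff ℝ ∞ u) (hv : ContDiff ℝ ∞ v) :
    pd e i (u + v) = pd e i u + pd e i v := by
  funext x
  simp [pd, fderiv_add (hu.differentiable (by simp) x) (hv.differentiable (by simp) x)]

theorem pd_neg (e : ι → E) (i : ι) (u : E → ℝ) : pd e i (-u) = -pd e i u := by
  funext x
  simp [pd, fderiv_neg]

theorem pd_mul (e : ι → E) (i : ι) {u v : E → ℝ} (hu : ContDiff ℝ ∞ u) (hv : ContDiff ℝ ∞ v) :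
    pd e i (u * v) = pd e i u * v + u * pd e i v := by
  funext x
  simp [pd, fderiv_mul (hu.differentiable (by simp) x) (hv.differentiable (by simp) x)]
  ring

theorem pds_add (e : ι → E) (w : List ι) {u v : E → ℝ} (hu : ContDiff ℝ ∞ u)
    (hv : ContDiff ℝ ∞ v) : pds e w (u + v) = pds e w u + pds e w v := by
  induction w with
  | nil => rfl
  | cons i w ih =>
    simp only [pds, ih]
    exact pd_add e i (contDiff_pds e w hu) (contDiff_pds e w hv)

theorem pds_neg (e : ι → E) (w : List ι) (u : E → ℝ) : pds e w (-u) = -pds e w u := by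
  induction w with
  | nil => rfl
  | cons i w ih => simp only [pds, ih, pd_neg]

theorem pds_append_singleton (e : ι → E) (w : List ι) (i : ι) (u : E → ℝ) :
    pds e (w ++ [i]) u = pds e w (pd e i u) := by
  induction w with
  | nil => rfl
  | cons j w ih => simp only [List.cons_append, pds, ih]

theorem seminorm_nonneg (e : ι → E) (K : Set E) (l : ℕ) (u : E → ℝ) : 0 ≤ seminorm e K l u :=
  Real.sSup_nonneg (by rintro t ⟨w, _, x, _, rfl⟩; exact abs_nonneg _)

theorem seminorm_le {e : ι → E} {K : Set E} {l : ℕ} {u : E → ℝ} {c : ℝ} (hc : 0 ≤ c)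
    (h : ∀ w : List ι, w.length ≤ l → ∀ x ∈ K, |pds e w u x| ≤ c) : seminorm e K l u ≤ c :=
  Real.sSup_le (by rintro t ⟨w, hw, x, hx, rfl⟩; exact h w hw x hx) hc

theorem le_seminorm [Finite ι] (e : ι → E) {K : Set E} (hK : IsCompact K) {l : ℕ} {u : E → ℝ}
    (hu : ContDiff ℝ ∞ u) {w : List ι} (hw : w.length ≤ l) {x : E} (hx : x ∈ K) :
    |pds e w u x| ≤ seminorm e K l u := by
  refine le_csSup ?_ ⟨w, hw, x, hx, rfl⟩
  have hfin : {w : List ι | w.length ≤ l}.Finite := List.finite_length_le ι l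
  have hb : BddAbove (⋃ w ∈ {w : List ι | w.length ≤ l}, (fun x => |pds e w u x|) '' K) :=
    hfin.bddAbove_biUnion.2 fun w _ =>
      hK.bddAbove_image ((contDiff_pds e w hu).continuous.abs.continuousOn)
  refine hb.mono ?_
  rintro t ⟨w, hw, x, hx, rfl⟩
  exact mem_biUnion (x := w) hw ⟨x, hx, rfl⟩

theorem seminorm_add_le [Finite ι] (e : ι → E) {K : Set E} (hK : IsCompact K) (l : ℕ)
    {u v : E → ℝ} (hu : ContDiff ℝ ∞ u) (hv : ContDiff ℝ ∞ v) :
    seminorm e K l (u + v) ≤ seminorm e K l u + seminorm e K l v := by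
  refine seminorm_le (add_nonneg (seminorm_nonneg ..) (seminorm_nonneg ..)) fun w hw x hx => ?_
  rw [pds_add e w hu hv]
  exact (abs_add_le _ _).trans
    (add_le_add (le_seminorm e hK hu hw hx) (le_seminorm e hK hv hw hx))

theorem seminorm_zero (e : ι → E) (K : Set E) (l : ℕ) : seminorm e K l (0 : E → ℝ) = 0 := by
  have h : ∀ w : List ι, pds e w (0 : E → ℝ) = 0 := by
    intro w
    induction w with
    | nil => rfl
    | cons i w ih =>
      funext x
      simp [pds, ih, pd]
  refine le_antisymm (seminorm_le le_rfl fun w _ x _ => ?_) (seminorm_nonneg ..)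
  simp [h w]

theorem seminorm_neg (e : ι → E) (K : Set E) (l : ℕ) (u : E → ℝ) :
    seminorm e K l (-u) = seminorm e K l u := by
  simp only [seminorm, pds_neg, Pi.neg_apply, abs_neg]

theorem seminorm_mono [Finite ι] (e : ι → E) {K : Set E} (hK : IsCompact K) {l m : ℕ} (h : l ≤ m)
    {u : E → ℝ} (hu : ContDiff ℝ ∞ u) : seminorm e K l u ≤ seminorm e K m u :=
  seminorm_le (seminorm_nonneg ..) fun _ hw _ hx => le_seminorm e hK hu (hw.trans h) hx

theorem seminorm_pd_le [Finite ι] (e : ι → E) {K : Set E} (hK : IsCompact K) (l : ℕ) (i : ι)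
    {u : E → ℝ} (hu : ContDiff ℝ ∞ u) : seminorm e K l (pd e i u) ≤ seminorm e K (l + 1) u := by
  refine seminorm_le (seminorm_nonneg ..) fun w hw x hx => ?_
  rw [← pds_append_singleton]
  exact le_seminorm e hK hu (by simpa using hw) hx

theorem seminorm_mul_le [Finite ι] (e : ι → E) {K : Set E} (hK : IsCompact K) (l : ℕ) :
    ∀ {u v : E → ℝ}, ContDiff ℝ ∞ u → ContDiff ℝ ∞ v →
      seminorm e K l (u * v) ≤ 2 ^ l * (seminorm e K l u * seminorm e K l v) := by
  induction l with
  | zero =>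
    intro u v hu hv
    refine seminorm_le (by have := seminorm_nonneg e K 0 u
                           have := seminorm_nonneg e K 0 v
                           positivity) fun w hw x hx => ?_
    have hw' : w = [] := by simpa using hw
    subst hw'
    have h1 := le_seminorm e hK hu (w := []) (l := 0) (by simp) hx
    have h2 := le_seminorm e hK hv (w := []) (l := 0) (by simp) hx
    simp only [pds, Pi.mul_apply, abs_mul, pow_zero, one_mul] at *
    exact mul_le_mul h1 h2 (abs_nonneg _) (seminorm_nonneg ..)
  | succ l ih =>
    intro u v hu hv
    have nu := seminorm_nonneg e K (l + 1) u
    have nv := seminorm_nonneg e K (l + 1) v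
    have mu := seminorm_mono e hK (Nat.le_succ l) hu
    have mv := seminorm_mono e hK (Nat.le_succ l) hv
    refine seminorm_le (by positivity) fun w hw x hx => ?_
    rcases List.eq_nil_or_concat w with rfl | ⟨w, i, rfl⟩
    · have h1 := le_seminorm e hK hu (w := []) (l := l + 1) (by simp) hx
      have h2 := le_seminorm e hK hv (w := []) (l := l + 1) (by simp) hx
      simp only [pds, Pi.mul_apply, abs_mul] at *
      refine (mul_le_mul h1 h2 (abs_nonneg _) nu).trans ?_
      exact le_mul_of_one_le_left (by positivity) (one_le_pow₀ (by norm_num))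
    · rw [List.concat_eq_append] at hw ⊢
      rw [pds_append_singleton, pd_mul e i hu hv]
      have hi := contDiff_pd e i hu
      have hj := contDiff_pd e i hv
      refine (le_seminorm e hK ((hi.mul hv).add (hu.mul hj)) (l := l)
        (by simpa using hw) hx).trans ?_
      refine (seminorm_add_le e hK l (hi.mul hv) (hu.mul hj)).trans ?_
      have A := (ih hi hv).trans (mul_le_mul_of_nonneg_left (mul_le_mul
        (seminorm_pd_le e hK l i hu) mv (seminorm_nonneg ..) nu) (by positivity))
      have B := (ih hu hj).trans (mul_le_mul_of_nonneg_left (mul_le_mul mu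
        (seminorm_pd_le e hK l i hv) (seminorm_nonneg ..) nu) (by positivity))
      refine (add_le_add A B).trans (le_of_eq ?_)
      ring

/-! ### Moderate and negligible families, and the algebra of generalized functions -/

/-- Membership in `X(E)`. -/
def IsModerate (C : Scale) (e : ι → E) (u : Idx → E → ℝ) : Prop :=
  (∀ ε, ContDiff ℝ ∞ (u ε)) ∧
    ∀ K : Set E, IsCompact K → ∀ l : ℕ, (fun ε => seminorm e K l (u ε)) ∈ C.absA

/-- Membership in `N(E)`. -/
def IsNegligible (C : Scale) (e : ι → E) (u : Idx → E → ℝ) : Prop :=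
  (∀ ε, ContDiff ℝ ∞ (u ε)) ∧
    ∀ K : Set E, IsCompact K → ∀ l : ℕ, (fun ε => seminorm e K l (u ε)) ∈ C.absI

theorem IsModerate.mem {C : Scale} {e : ι → E} {u : Idx → E → ℝ} (hu : IsModerate C e u)
    {K : Set E} (hK : IsCompact K) (l : ℕ) : (fun ε => seminorm e K l (u ε)) ∈ C.A :=
  (Scale.mem_absA fun _ => seminorm_nonneg ..).1 (hu.2 K hK l)

theorem isModerate_const (C : Scale) (e : ι → E) {φ : E → ℝ} (hφ : ContDiff ℝ ∞ φ) :
    IsModerate C e (fun _ => φ) :=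
  ⟨fun _ => hφ, fun _ _ _ => (Scale.mem_absA fun _ => seminorm_nonneg ..).2 (C.const_mem _)⟩

/-- The ring `X(E)` of moderate families. -/
def X (C : Scale) (e : ι → E) [Finite ι] : Subring (Idx → E → ℝ) where
  carrier := {u | IsModerate C e u}
  zero_mem' := isModerate_const C e contDiff_const
  one_mem' := isModerate_const C e contDiff_const
  add_mem' {u v} hu hv := ⟨fun ε => (hu.1 ε).add (hv.1 ε), fun K hK l =>
    Scale.absA_of_le (fun _ => seminorm_nonneg ..) (C.A.add_mem (hu.mem hK l) (hv.mem hK l))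
      fun ε => seminorm_add_le e hK l (hu.1 ε) (hv.1 ε)⟩
  neg_mem' {u} hu := ⟨fun ε => (hu.1 ε).neg, fun K hK l => by
    simpa only [Pi.neg_apply, seminorm_neg] using hu.2 K hK l⟩
  mul_mem' {u v} hu hv := ⟨fun ε => (hu.1 ε).mul (hv.1 ε), fun K hK l =>
    Scale.absA_of_le (fun _ => seminorm_nonneg ..)
      (C.A.mul_mem (C.const_mem (2 ^ l)) (C.A.mul_mem (hu.mem hK l) (hv.mem hK l)))
      fun ε => seminorm_mul_le e hK l (hu.1 ε) (hv.1 ε)⟩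

/-- The ideal `N(E)` of negligible families. -/
def N (C : Scale) (e : ι → E) [Finite ι] : Ideal (X C e) where
  carrier := {u | IsNegligible C e u.1}
  zero_mem' := ⟨fun _ => contDiff_const, fun K hK l =>
    Scale.absI_of_le (t := 0) (fun _ => seminorm_nonneg ..) C.I.zero_mem fun _ =>
      (seminorm_zero e K l).le⟩
  add_mem' {u v} hu hv := ⟨fun ε => (hu.1 ε).add (hv.1 ε), fun K hK l => by
    obtain ⟨h1, i1⟩ := (Scale.mem_absI fun _ => seminorm_nonneg ..).1 (hu.2 K hK l)
    obtain ⟨h2, i2⟩ := (Scale.mem_absI fun _ => seminorm_nonneg ..).1 (hv.2 K hK l)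
    exact Scale.absI_of_le (fun _ => seminorm_nonneg ..) (C.I.add_mem i1 i2)
      fun ε => seminorm_add_le e hK l (hu.1 ε) (hv.1 ε)⟩
  smul_mem' u v hv := ⟨fun ε => (u.2.1 ε).mul (hv.1 ε), fun K hK l => by
    obtain ⟨h2, i2⟩ := (Scale.mem_absI fun _ => seminorm_nonneg ..).1 (hv.2 K hK l)
    exact Scale.absI_of_le (fun _ => seminorm_nonneg ..)
      (C.I.mul_mem_left (⟨_, C.const_mem (2 ^ l)⟩ * ⟨_, u.2.mem hK l⟩) i2)
      fun ε => (seminorm_mul_le e hK l (u.2.1 ε) (hv.1 ε)).trans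
        (le_of_eq (mul_assoc _ _ _).symm)⟩

/-- The algebra of generalized functions `A(E) = X(E) / N(E)`. -/
abbrev GenAlg (C : Scale) (e : ι → E) [Finite ι] : Type := X C e ⧸ N C e

/-- The class `[u_ε]`. -/
def cls {C : Scale} {e : ι → E} [Finite ι] (u : Idx → E → ℝ) (hu : IsModerate C e u) :
    GenAlg C e :=
  Ideal.Quotient.mk (N C e) ⟨u, hu⟩

/-- The map on classes induced by a map on representatives that sends moderate families to
moderate families and respects negligible differences. -/
def mapCls {ι' : Type} {E' : Type} [NormedAddCommGroup E'] [NormedSpace ℝ E'] {C : Scale}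
    {e : ι → E} [Finite ι] {e' : ι' → E'} [Finite ι'] (T : (Idx → E → ℝ) → (Idx → E' → ℝ))
    (h₁ : ∀ u, IsModerate C e u → IsModerate C e' (T u))
    (h₂ : ∀ u v, IsModerate C e u → IsModerate C e v → IsNegligible C e (u - v) →
      IsNegligible C e' (T u - T v)) : GenAlg C e → GenAlg C e' :=
  Quotient.lift (fun u : X C e => cls (T u.1) (h₁ u.1 u.2)) fun u v huv =>
    Ideal.Quotient.eq.2 (h₂ u.1 v.1 u.2 v.2
      (Ideal.Quotient.eq.1 (Quotient.sound huv : (Ideal.Quotient.mk (N C e) u) = _)))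

/-- The generalized partial derivative `[u_ε] ↦ [∂_i u_ε]`. -/
def gpd {C : Scale} {e : ι → E} [Finite ι] (i : ι) : GenAlg C e → GenAlg C e :=
  mapCls (fun u ε => pd e i (u ε))
    (fun u hu => ⟨fun ε => contDiff_pd e i (hu.1 ε), fun _ hK l =>
      Scale.absA_of_le (fun _ => seminorm_nonneg ..) (hu.mem hK (l + 1))
        fun ε => seminorm_pd_le e hK l i (hu.1 ε)⟩)
    (fun u v hu hv h => by
      have hpd : ((fun ε => pd e i (u ε)) - fun ε => pd e i (v ε)) =
          fun ε => pd e i ((u - v) ε) := by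
        funext ε
        have hvn : ContDiff ℝ ∞ (-v ε) := (hv.1 ε).neg
        simp only [Pi.sub_apply, sub_eq_add_neg]
        rw [pd_add e i (hu.1 ε) hvn, pd_neg]
      rw [hpd]
      refine ⟨fun ε => contDiff_pd e i (h.1 ε), fun K hK l => ?_⟩
      obtain ⟨_, hI⟩ := (Scale.mem_absI fun _ => seminorm_nonneg ..).1 (h.2 K hK (l + 1))
      exact Scale.absI_of_le (fun _ => seminorm_nonneg ..) hI
        fun ε => seminorm_pd_le e hK l i (h.1 ε))

/-! ### The generalized operator associated to a nonlinearity -/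

/-- The function `F(·, ·, u)`. -/
def comp₃ (F : ℝ × ℝ × ℝ → ℝ) (u : ℝ × ℝ → ℝ) : ℝ × ℝ → ℝ := fun p => F (p.1, p.2, u p)

theorem contDiff_comp₃ {F : ℝ × ℝ × ℝ → ℝ} (hF : ContDiff ℝ ∞ F) {u : ℝ × ℝ → ℝ}
    (hu : ContDiff ℝ ∞ u) : ContDiff ℝ ∞ (comp₃ F u) :=
  hF.comp (contDiff_fst.prodMk (contDiff_snd.prodMk hu))

/-- `A(ℝ²)` is stable under `F` relatively to the ring of scales: `P_{K,l}` of `F(·,·,u_ε)`, and of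
differences `F(·,·,v_ε) - F(·,·,u_ε)`, is bounded by a polynomial in `P_{K,l}(u_ε)`, respectively by
a polynomial without constant term in `P_{K,l}(v_ε - u_ε)`. The positive coefficients belong to the
ring of scales (in particular they may be constants), and may depend on `K`, `l` and on the
families. The second condition has content only for `l ≥ 1`; for `l = 0` the sum would be empty. -/
def StableUnder (C : Scale) (F : ℝ × ℝ × ℝ → ℝ) : Prop :=
  (∀ K : Set (ℝ × ℝ), IsCompact K → ∀ l : ℕ, ∀ u, IsModerate C e₂ u →
    ∃ c : ℕ → Idx → ℝ, (∀ i, c i ∈ C.A ∧ ∀ ε, 0 < c i ε) ∧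
      ∀ ε, seminorm e₂ K l (comp₃ F (u ε)) ≤
        ∑ i ∈ Finset.range (l + 1), c i ε * seminorm e₂ K l (u ε) ^ i) ∧
  (∀ K : Set (ℝ × ℝ), IsCompact K → ∀ l : ℕ, 1 ≤ l → ∀ v u,
    IsModerate C e₂ v → IsModerate C e₂ u →
    ∃ d : ℕ → Idx → ℝ, (∀ j, d j ∈ C.A ∧ ∀ ε, 0 < d j ε) ∧
      ∀ ε, seminorm e₂ K l (comp₃ F (v ε) - comp₃ F (u ε)) ≤
        ∑ j ∈ Finset.Icc 1 l, d j ε * seminorm e₂ K l (v ε - u ε) ^ j)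

theorem StableUnder.isModerate {C : Scale} {F : ℝ × ℝ × ℝ → ℝ} (hF : ContDiff ℝ ∞ F)
    (h : StableUnder C F) (u : Idx → ℝ × ℝ → ℝ) (hu : IsModerate C e₂ u) :
    IsModerate C e₂ (fun ε => comp₃ F (u ε)) := by
  refine ⟨fun ε => contDiff_comp₃ hF (hu.1 ε), fun K hK l => ?_⟩
  obtain ⟨c, hc, hle⟩ := h.1 K hK l u hu
  refine Scale.absA_of_le (t := ∑ i ∈ Finset.range (l + 1),
    c i * (fun ε => seminorm e₂ K l (u ε)) ^ i) (fun _ => seminorm_nonneg ..) ?_ ?_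
  · exact C.A.sum_mem fun i _ => C.A.mul_mem (hc i).1 (C.A.pow_mem (hu.mem hK l) i)
  · intro ε
    simpa [Finset.sum_apply] using hle ε

theorem StableUnder.isNegligible {C : Scale} {F : ℝ × ℝ × ℝ → ℝ} (hF : ContDiff ℝ ∞ F)
    (h : StableUnder C F) (v u : Idx → ℝ × ℝ → ℝ) (hv : IsModerate C e₂ v)
    (hu : IsModerate C e₂ u) (hvu : IsNegligible C e₂ (v - u)) :
    IsNegligible C e₂ ((fun ε => comp₃ F (v ε)) - fun ε => comp₃ F (u ε)) := by
  have hs : ∀ ε, ContDiff ℝ ∞ (comp₃ F (v ε) - comp₃ F (u ε)) := fun ε =>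
    (contDiff_comp₃ hF (hv.1 ε)).sub (contDiff_comp₃ hF (hu.1 ε))
  refine ⟨hs, fun K hK l => ?_⟩
  obtain ⟨d, hd, hle⟩ := h.2 K hK (l + 1) (by omega) v u hv hu
  obtain ⟨hA, hI⟩ := (Scale.mem_absI fun _ => seminorm_nonneg ..).1 (hvu.2 K hK (l + 1))
  refine Scale.absI_of_le (t := ∑ j ∈ Finset.Icc 1 (l + 1),
    ⟨d j, (hd j).1⟩ * ⟨_, hA⟩ ^ j) (fun _ => seminorm_nonneg ..) ?_ ?_
  · exact C.I.sum_mem fun j hj => C.I.mul_mem_left _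
      (C.I.pow_mem_of_mem hI j (by simp at hj; omega))
  · intro ε
    refine (seminorm_mono e₂ hK (Nat.le_succ l) (hs ε)).trans ((hle ε).trans (le_of_eq ?_))
    simp [Finset.sum_apply]

/-- The generalized operator `[u_ε] ↦ [F(·,·,u_ε)]`. -/
def genOp {C : Scale} {F : ℝ × ℝ × ℝ → ℝ} (hF : ContDiff ℝ ∞ F) (h : StableUnder C F) :
    GenAlg C e₂ → GenAlg C e₂ :=
  mapCls (fun u ε => comp₃ F (u ε)) (h.isModerate hF) (h.isNegligible hF)

/-! ### Generalized restriction to the curves `y = f_ε(x)` -/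

/-- The function `x ↦ u(x, f(x))`. -/
def restr (f : ℝ → ℝ) (u : ℝ × ℝ → ℝ) : ℝ → ℝ := fun x => u (x, f x)

/-- The family `(f_ε)` is compatible with second side restriction. -/
def CompatibleRestr (C : Scale) (f : Idx → ℝ → ℝ) : Prop :=
  (∀ u, IsModerate C e₂ u → IsModerate C e₁ (fun ε => restr (f ε) (u ε))) ∧
    ∀ u, IsNegligible C e₂ u → IsNegligible C e₁ (fun ε => restr (f ε) (u ε))

/-- The generalized second side restriction mapping `[u_ε] ↦ [u_ε(·, f_ε(·))]`. -/
def genRestr {C : Scale} {f : Idx → ℝ → ℝ} (h : CompatibleRestr C f) :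
    GenAlg C e₂ → GenAlg C e₁ :=
  mapCls (fun u ε => restr (f ε) (u ε)) h.1 (fun u v _ _ huv => h.2 (u - v) huv)

/-! ### The Cauchy problems -/

/-- `u` is a smooth solution of `∂²u/∂x∂y = F(·,·,u)`, `u = φ` and `∂u/∂y = ψ` on the curve
`y = f(x)`. -/
def IsClassicalSolution (F : ℝ × ℝ × ℝ → ℝ) (f φ ψ : ℝ → ℝ) (u : ℝ × ℝ → ℝ) : Prop :=
  ContDiff ℝ ∞ u ∧
  (∀ x y : ℝ, pd e₂ 0 (pd e₂ 1 u) (x, y) = F (x, y, u (x, y))) ∧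
  (∀ x : ℝ, u (x, f x) = φ x) ∧
  (∀ x : ℝ, pd e₂ 1 u (x, f x) = ψ x)

/-- The generalized function `u` solves `∂²u/∂x∂y = 𝓕(u)`, `R(u) = φ`, `R(∂u/∂y) = ψ`. -/
def IsGenSolution {C : Scale} {F : ℝ × ℝ × ℝ → ℝ} (hF : ContDiff ℝ ∞ F) (hFC : StableUnder C F)
    {f : Idx → ℝ → ℝ} (hf : CompatibleRestr C f) {φ ψ : ℝ → ℝ} (hφ : ContDiff ℝ ∞ φ)
    (hψ : ContDiff ℝ ∞ ψ) (u : GenAlg C e₂) : Prop :=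
  gpd 0 (gpd 1 u) = genOp hF hFC u ∧
  genRestr hf u = cls (fun _ => φ) (isModerate_const C e₁ hφ) ∧
  genRestr hf (gpd 1 u) = cls (fun _ => ψ) (isModerate_const C e₁ hψ)

/-! ### Growth conditions -/

/-- `O_M(ℝ)`: smooth functions of slow growth. -/
def SlowGrowth (f : ℝ → ℝ) : Prop :=
  ContDiff ℝ ∞ f ∧ ∀ m : ℕ, ∃ q : ℕ, ∃ c : ℝ, ∀ k ≤ m, ∀ x : ℝ,
    |iteratedDeriv k f x| ≤ c * (1 + |x|) ^ q

/-- `X_τ(ℝ)`: tempered moderate families; the inner bound says that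
`sup_x sup_{k ≤ m} (1 + |x|)^(-q) |f_ε^(k)(x)| = O(ε^(-N))` as `ε → 0`. -/
def Tempered (f : Idx → ℝ → ℝ) : Prop :=
  (∀ ε, SlowGrowth (f ε)) ∧ ∀ m : ℕ, ∃ q N : ℕ, ∃ c : ℝ, ∃ ε₀ : Idx, ∀ ε, ε < ε₀ →
    ∀ k ≤ m, ∀ x : ℝ,
      |iteratedDeriv k (f ε) x| ≤ c * ((ε : ℝ) ^ N)⁻¹ * (1 + |x|) ^ q

/-- `(f_ε)` is c-bounded. -/
def CBounded (f : Idx → ℝ → ℝ) : Prop :=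
  ∀ K : Set ℝ, IsCompact K → ∃ L : Set ℝ, IsCompact L ∧ ∀ ε, f ε '' K ⊆ L

/-- `f_ε → f₀` in `D'(ℝ)` as `ε → 0`, for a locally integrable function `f₀`. -/
def ConvergesInD (f : Idx → ℝ → ℝ) (f₀ : ℝ → ℝ) : Prop :=
  LocallyIntegrable f₀ ∧ ∀ θ : ℝ → ℝ, ContDiff ℝ ∞ θ → HasCompactSupport θ →
    Tendsto (fun ε : Idx => ∫ x, f ε x * θ x) (comap (fun ε : Idx => (ε : ℝ)) (𝓝[>] 0))
      (𝓝 (∫ x, f₀ x * θ x))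

/-! ### The compacts attached to a rectangle `[-a, a] × [-b, b]` -/

/-- `β_{K,ε}`. -/
def betaK (f : ℝ ≃o ℝ) (a b : ℝ) : ℝ := max a (f.symm b)

/-- `α_{K,ε}`. -/
def alphaK (f : ℝ ≃o ℝ) (a b : ℝ) : ℝ := min (-a) (f.symm (-b))

/-- `a_{K,ε}`. -/
def widthK (f : ℝ ≃o ℝ) (a b : ℝ) : ℝ := 2 * max (betaK f a b) |alphaK f a b|

/-- `K_ε = [-a_{K,ε}/2, a_{K,ε}/2] × [-b, b]`. -/
def compactK (f : ℝ ≃o ℝ) (a b : ℝ) : Set (ℝ × ℝ) :=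
  Icc (-(widthK f a b / 2)) (widthK f a b / 2) ×ˢ Icc (-b) b

/-- `[α_{K,ε}, β_{K,ε}] × [-b, b]`. -/
def compactL (f : ℝ ≃o ℝ) (a b : ℝ) : Set (ℝ × ℝ) :=
  Icc (alphaK f a b) (betaK f a b) ×ˢ Icc (-b) b

end GenFun

end

open GenFun

/-!
The proof rests on the fact that `F` and all its derivatives are bounded on `K_ε × ℝ` by multiples
of `M_ε`, uniformly in the last variable. No Gronwall argument is then necessary: on the box
`[f_ε⁻¹(-b), f_ε⁻¹(b)] × [-b, b]`, which the curve crosses from corner to corner and which therefore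
contains the horizontal and the vertical segment joining any of its points to the curve, one
integration of `∂²u/∂x∂y = F(·,·,u)` bounds `∂u/∂y`, and a second one bounds `u`.

The derivatives are estimated by induction on their order. A mixed derivative of order `n + 1` is a
derivative of order `n - 1` of `F(·,·,u)`, which the chain rule expresses by derivatives of `u` of
lower order. A pure derivative of order `n + 1` has a derivative in the other direction that is a
derivative of order `n` of `F(·,·,u)`, hence is already bounded, and integration from the curve
reduces it to its trace `y ↦ (∂^α u)(f_ε⁻¹(y), y)`. These traces have all their derivatives bounded
on `[-b, b]` by elements of `A`: those of `u` and `∂u/∂y` are `φ ∘ f_ε⁻¹` and `ψ ∘ f_ε⁻¹`, which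
are moderate because `φ`, `ψ` grow slowly and `(f_ε⁻¹)` is tempered, and the others are found by
differentiating along the curve; the pure `x`-derivatives require a division by `(f_ε⁻¹)'`, that is,
a multiplication by the moderate family `f_ε' ∘ f_ε⁻¹`.

Both inductions have the same form (`derivIn_of_pure`), once for the ring `traceRing` of families
with good traces (`derivIn_traceRing`) and once for the ring of families bounded on the boxes
(`derivIn_boundedOn`). The c-boundedness of `(f_ε)` puts every `L_ε(A, B)`, and every fixed
compact set, into such boxes. Since the ring of scales is overgenerated, membership in `A` only
depends on small `ε`. Membership in the ideal `I_A` need not, so compatibility with restriction is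
derived from an inequality between seminorms that holds for all `ε` (`exists_seminorm_restr_le`).
-/

noncomputable section

namespace GenFun

variable {ι ι' E E' : Type} [NormedAddCommGroup E] [NormedSpace ℝ E]
  [NormedAddCommGroup E'] [NormedSpace ℝ E']

/-! ### Overgenerated rings of scales -/

/-- Membership in an overgenerated ring of scales only depends on small values of `ε`. -/
theorem Scale.OvergeneratedBy.mem_of_eventually_le {C : Scale} {p : ℕ} {g : Fin p → Idx → ℝ}
    (hC : C.OvergeneratedBy g) {s t : Idx → ℝ} (ht : t ∈ C.A) {ε₀ : Idx}
    (h : ∀ ε, ε < ε₀ → |s ε| ≤ t ε) : s ∈ C.A := by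
  obtain ⟨b, hb, ε₁, h₁⟩ := (hC.2 t).1 ht
  exact (hC.2 s).2 ⟨b, hb, min ε₀ ε₁, fun ε hε => (h ε (lt_of_lt_of_le hε (min_le_left _ _))).trans
    ((le_abs_self _).trans (h₁ ε (lt_of_lt_of_le hε (min_le_right _ _))))⟩

theorem posPoly_X {p : ℕ} (i : Fin p) : PosPoly (MvPolynomial.X i) := by
  classical
  refine ⟨MvPolynomial.X_ne_zero i, fun m => ?_⟩
  rw [MvPolynomial.coeff_X]
  split_ifs <;> norm_num

theorem posPoly_one {p : ℕ} : PosPoly (1 : MvPolynomial (Fin p) ℝ) := by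
  classical
  refine ⟨one_ne_zero, fun m => ?_⟩
  rw [MvPolynomial.coeff_one]
  split_ifs <;> norm_num

theorem Scale.OvergeneratedBy.gen_mem {C : Scale} {p : ℕ} {g : Fin p → Idx → ℝ}
    (hC : C.OvergeneratedBy g) (i : Fin p) : g i ∈ C.A :=
  (hC.2 _).2 ⟨g i, ⟨_, _, posPoly_X i, posPoly_one, fun ε => by simp⟩, ⟨1, by simp⟩,
    fun ε _ => (abs_of_pos (hC.1 i ε)).le⟩

theorem Scale.OvergeneratedBy.inv_gen_mem {C : Scale} {p : ℕ} {g : Fin p → Idx → ℝ}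
    (hC : C.OvergeneratedBy g) (i : Fin p) : (fun ε => (g i ε)⁻¹) ∈ C.A :=
  (hC.2 _).2 ⟨fun ε => (g i ε)⁻¹, ⟨_, _, posPoly_one, posPoly_X i, fun ε => by simp⟩,
    ⟨1, by simp⟩, fun ε _ => (abs_of_pos (inv_pos.2 (hC.1 i ε))).le⟩

/-! ### Families with bounded derivatives -/

/-- The ring of families that are bounded on the sets `S ε`, for small `ε`, by an element of the
ring of scales. -/
def boundedOn (C : Scale) (S : Idx → Set E) : Subring (Idx → E → ℝ) where
  carrier := {v | ∃ t ∈ C.A, ∃ ε₀ : Idx, ∀ ε, ε < ε₀ → ∀ p ∈ S ε, |v ε p| ≤ t ε}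
  zero_mem' := ⟨0, C.A.zero_mem, ⟨1, by simp⟩, fun ε _ p _ => by simp⟩
  one_mem' := ⟨1, C.A.one_mem, ⟨1, by simp⟩, fun ε _ p _ => by simp⟩
  add_mem' := by
    rintro v w ⟨s, hs, ε₀, h₀⟩ ⟨t, ht, ε₁, h₁⟩
    exact ⟨s + t, C.A.add_mem hs ht, min ε₀ ε₁, fun ε hε p hp => (abs_add_le _ _).trans
      (add_le_add (h₀ ε (lt_of_lt_of_le hε (min_le_left _ _)) p hp)
        (h₁ ε (lt_of_lt_of_le hε (min_le_right _ _)) p hp))⟩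
  neg_mem' := by
    rintro v ⟨s, hs, ε₀, h₀⟩
    exact ⟨s, hs, ε₀, fun ε hε p hp => by simpa using h₀ ε hε p hp⟩
  mul_mem' := by
    rintro v w ⟨s, hs, ε₀, h₀⟩ ⟨t, ht, ε₁, h₁⟩
    refine ⟨s * t, C.A.mul_mem hs ht, min ε₀ ε₁, fun ε hε p hp => ?_⟩
    have h₂ := h₀ ε (lt_of_lt_of_le hε (min_le_left _ _)) p hp
    have h₃ := h₁ ε (lt_of_lt_of_le hε (min_le_right _ _)) p hp
    simp only [Pi.mul_apply, abs_mul]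
    exact mul_le_mul h₂ h₃ (abs_nonneg _) ((abs_nonneg _).trans h₂)

/-- The families of smooth functions whose partial derivatives of order at most `n` lie in the
ring `R` of families. -/
def DerivIn (e : ι → E) (R : Subring (Idx → E → ℝ)) (n : ℕ) (v : Idx → E → ℝ) : Prop :=
  (∀ ε, ContDiff ℝ ∞ (v ε)) ∧ ∀ w : List ι, w.length ≤ n → (fun ε => pds e w (v ε)) ∈ R

section DerivIn

variable {e : ι → E} {R : Subring (Idx → E → ℝ)} {n : ℕ} {u v : Idx → E → ℝ}

theorem DerivIn.mono {m : ℕ} (h : DerivIn e R n v) (hm : m ≤ n) : DerivIn e R m v :=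
  ⟨h.1, fun w hw => h.2 w (hw.trans hm)⟩

theorem DerivIn.mem (h : DerivIn e R n v) : v ∈ R := h.2 [] (by simp)

theorem derivIn_zero : DerivIn e R 0 v ↔ (∀ ε, ContDiff ℝ ∞ (v ε)) ∧ v ∈ R := by
  refine ⟨fun h => ⟨h.1, h.mem⟩, fun h => ⟨h.1, fun w hw => ?_⟩⟩
  obtain rfl : w = [] := by simpa using hw
  exact h.2

theorem derivIn_succ : DerivIn e R (n + 1) v ↔
    (∀ ε, ContDiff ℝ ∞ (v ε)) ∧ v ∈ R ∧ ∀ i, DerivIn e R n (fun ε => pd e i (v ε)) := by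
  refine ⟨fun h => ⟨h.1, h.mem, fun i => ⟨fun ε => contDiff_pd e i (h.1 ε), fun w hw => ?_⟩⟩,
    fun h => ⟨h.1, fun w hw => ?_⟩⟩
  · simp only [← pds_append_singleton]
    exact h.2 _ (by simpa using hw)
  · rcases List.eq_nil_or_concat w with rfl | ⟨w, i, rfl⟩
    · exact h.2.1
    · simp only [List.concat_eq_append, pds_append_singleton] at hw ⊢
      exact (h.2.2 i).2 w (by simpa using hw)

theorem DerivIn.pd (h : DerivIn e R (n + 1) v) (i : ι) : DerivIn e R n (fun ε => pd e i (v ε)) :=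
  (derivIn_succ.1 h).2.2 i

theorem derivIn_const {c : ℝ} (hc : (fun _ _ => c) ∈ R) : DerivIn e R n (fun _ _ => c) := by
  induction n generalizing c with
  | zero => exact derivIn_zero.2 ⟨fun _ => contDiff_const, hc⟩
  | succ n ih =>
    refine derivIn_succ.2 ⟨fun _ => contDiff_const, hc, fun i => ?_⟩
    have : (fun _ : Idx => GenFun.pd e i (fun _ : E => c)) = fun _ _ => 0 := by
      funext ε x
      simp [GenFun.pd]
    rw [this]
    exact ih R.zero_mem

theorem DerivIn.add (hu : DerivIn e R n u) (hv : DerivIn e R n v) : DerivIn e R n (u + v) := by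
  refine ⟨fun ε => (hu.1 ε).add (hv.1 ε), fun w hw => ?_⟩
  have : (fun ε => pds e w ((u + v) ε)) = (fun ε => pds e w (u ε)) + fun ε => pds e w (v ε) :=
    funext fun ε => pds_add e w (hu.1 ε) (hv.1 ε)
  rw [this]
  exact R.add_mem (hu.2 w hw) (hv.2 w hw)

theorem DerivIn.neg (hu : DerivIn e R n u) : DerivIn e R n (-u) := by
  refine ⟨fun ε => (hu.1 ε).neg, fun w hw => ?_⟩
  have : (fun ε => pds e w ((-u) ε)) = -(fun ε => pds e w (u ε)) :=
    funext fun ε => pds_neg e w (u ε)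
  rw [this]
  exact R.neg_mem (hu.2 w hw)

theorem DerivIn.mul (hu : DerivIn e R n u) (hv : DerivIn e R n v) : DerivIn e R n (u * v) := by
  induction n generalizing u v with
  | zero =>
    rw [derivIn_zero] at *
    exact ⟨fun ε => (hu.1 ε).mul (hv.1 ε), R.mul_mem hu.2 hv.2⟩
  | succ n ih =>
    refine derivIn_succ.2 ⟨fun ε => (hu.1 ε).mul (hv.1 ε), R.mul_mem hu.mem hv.mem, fun i => ?_⟩
    have : (fun ε => GenFun.pd e i ((u * v) ε)) =
        (fun ε => GenFun.pd e i (u ε)) * v + u * fun ε => GenFun.pd e i (v ε) :=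
      funext fun ε => pd_mul e i (hu.1 ε) (hv.1 ε)
    rw [this]
    exact (ih (hu.pd i) (hv.mono n.le_succ)).add (ih (hu.mono n.le_succ) (hv.pd i))

theorem derivIn_sum {κ : Type} (s : Finset κ) {v : κ → Idx → E → ℝ}
    (h : ∀ j ∈ s, DerivIn e R n (v j)) : DerivIn e R n (∑ j ∈ s, v j) := by
  classical
  induction s using Finset.induction_on with
  | empty => exact derivIn_const R.zero_mem
  | insert a s ha ih =>
    rw [Finset.sum_insert ha]
    exact (h a (Finset.mem_insert_self a s)).add
      (ih fun j hj => h j (Finset.mem_insert_of_mem hj))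

end DerivIn

/-- The ring of families all of whose partial derivatives lie in `R`. -/
def derivRing (e : ι → E) (R : Subring (Idx → E → ℝ)) : Subring (Idx → E → ℝ) where
  carrier := {v | ∀ n, DerivIn e R n v}
  zero_mem' _ := derivIn_const R.zero_mem
  one_mem' _ := derivIn_const R.one_mem
  add_mem' hu hv n := (hu n).add (hv n)
  neg_mem' hu n := (hu n).neg
  mul_mem' hu hv n := (hu n).mul (hv n)

theorem pd_mem_derivRing {e : ι → E} {R : Subring (Idx → E → ℝ)} {v : Idx → E → ℝ}
    (hv : v ∈ derivRing e R) (i : ι) : (fun ε => pd e i (v ε)) ∈ derivRing e R :=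
  fun n => (hv (n + 1)).pd i

theorem contDiff_sum_smul [Fintype ι'] (e' : ι' → E') {Φ : ι' → E → ℝ}
    (hΦ : ∀ j, ContDiff ℝ ∞ (Φ j)) : ContDiff ℝ ∞ (fun x => ∑ j, Φ j x • e' j) :=
  ContDiff.sum fun j _ => (hΦ j).smul contDiff_const

theorem pd_comp [Fintype ι'] (e : ι → E) (e' : ι' → E') (i : ι) {G : E' → ℝ}
    (hG : ContDiff ℝ ∞ G) {Φ : ι' → E → ℝ} (hΦ : ∀ j, ContDiff ℝ ∞ (Φ j)) (x : E) :
    pd e i (fun x => G (∑ j, Φ j x • e' j)) x =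
      ∑ j, pd e' j G (∑ j, Φ j x • e' j) * pd e i (Φ j) x := by
  have hd : ∀ j, HasFDerivAt (Φ j) (fderiv ℝ (Φ j) x) x := fun j =>
    ((hΦ j).differentiable (by simp) x).hasFDerivAt
  have hs : HasFDerivAt (fun x => ∑ j, Φ j x • e' j)
      (∑ j, (fderiv ℝ (Φ j) x).smulRight (e' j)) x :=
    HasFDerivAt.fun_sum fun j _ => (hd j).smul_const (e' j)
  have hc := ((hG.differentiable (by simp) (∑ j, Φ j x • e' j)).hasFDerivAt).comp x hs
  have hc' : fderiv ℝ (fun x => G (∑ j, Φ j x • e' j)) x = _ := hc.fderiv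
  simp only [pd, hc']
  simp [mul_comm]

/-- Chain rule with bounds: if all partial derivatives of `G` along the map with coordinates `Φ j`
lie in `R`, as well as the derivatives of `Φ j` of orders `1, …, n`, then so do the derivatives of
the composition up to the order `n`. -/
theorem derivIn_comp [Fintype ι'] (e : ι → E) (e' : ι' → E') {R : Subring (Idx → E → ℝ)}
    {G : Idx → E' → ℝ} (hG : ∀ ε, ContDiff ℝ ∞ (G ε)) {Φ : ι' → Idx → E → ℝ}
    (hΦ : ∀ j ε, ContDiff ℝ ∞ (Φ j ε))
    (hR : ∀ w : List ι', (fun ε x => pds e' w (G ε) (∑ j, Φ j ε x • e' j)) ∈ R) (n : ℕ)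
    (hΦR : ∀ i j k, k + 1 ≤ n → DerivIn e R k (fun ε => pd e i (Φ j ε))) (w : List ι') :
    DerivIn e R n (fun ε x => pds e' w (G ε) (∑ j, Φ j ε x • e' j)) := by
  have hs : ∀ w : List ι', ∀ ε,
      ContDiff ℝ ∞ (fun x => pds e' w (G ε) (∑ j, Φ j ε x • e' j)) := fun w ε =>
    (contDiff_pds e' w (hG ε)).comp (contDiff_sum_smul e' fun j => hΦ j ε)
  induction n generalizing w with
  | zero => exact derivIn_zero.2 ⟨hs w, hR w⟩
  | succ n ih =>
    refine derivIn_succ.2 ⟨hs w, hR w, fun i => ?_⟩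
    have : (fun ε => pd e i (fun x => pds e' w (G ε) (∑ j, Φ j ε x • e' j))) =
        ∑ j, (fun ε x => pds e' (j :: w) (G ε) (∑ j, Φ j ε x • e' j)) *
          fun ε => pd e i (Φ j ε) := by
      funext ε x
      rw [pd_comp e e' i (contDiff_pds e' w (hG ε)) fun j => hΦ j ε]
      simp [Finset.sum_apply, pds]
    rw [this]
    exact derivIn_sum _ fun j _ =>
      (ih (fun i j k hk => hΦR i j k (hk.trans n.le_succ)) (j :: w)).mul (hΦR i j n le_rfl)

/-! ### Tempered families -/

theorem pd_e₁ (i : Fin 1) (u : ℝ → ℝ) : pd e₁ i u = deriv u := by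
  funext x
  simp [pd, e₁]

theorem pds_e₁ (w : List (Fin 1)) (u : ℝ → ℝ) : pds e₁ w u = iteratedDeriv w.length u := by
  induction w with
  | nil => simp [pds]
  | cons i w ih => rw [pds, ih, pd_e₁, List.length_cons, iteratedDeriv_succ]

theorem SlowGrowth.tempered_const {φ : ℝ → ℝ} (hφ : SlowGrowth φ) : Tempered fun _ => φ := by
  refine ⟨fun _ => hφ, fun m => ?_⟩
  obtain ⟨q, c, h⟩ := hφ.2 m
  exact ⟨q, 0, c, ⟨1, by simp⟩, fun ε _ k hk x => by simpa using h k hk x⟩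

theorem SlowGrowth.deriv {φ : ℝ → ℝ} (hφ : SlowGrowth φ) : SlowGrowth (deriv φ) := by
  refine ⟨contDiff_infty_iff_deriv.1 hφ.1 |>.2, fun m => ?_⟩
  obtain ⟨q, c, h⟩ := hφ.2 (m + 1)
  exact ⟨q, c, fun k hk x => by
    rw [← iteratedDeriv_succ']
    exact h (k + 1) (by omega) x⟩

theorem Tempered.deriv {f : Idx → ℝ → ℝ} (hf : Tempered f) : Tempered fun ε => deriv (f ε) := by
  refine ⟨fun ε => (hf.1 ε).deriv, fun m => ?_⟩
  obtain ⟨q, N, c, ε₀, h⟩ := hf.2 (m + 1)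
  exact ⟨q, N, c, ε₀, fun ε hε k hk x => by
    rw [← iteratedDeriv_succ']
    exact h ε hε (k + 1) (by omega) x⟩

section Tempered

variable {C : Scale} (hinv : (fun ε : Idx => (ε : ℝ)⁻¹) ∈ C.A)

include hinv

theorem Tempered.iteratedDeriv_comp_mem {f : Idx → ℝ → ℝ} (hf : Tempered f) {S : Idx → Set ℝ}
    {g : Idx → ℝ → ℝ} (hg : g ∈ boundedOn C S) (k : ℕ) :
    (fun ε x => iteratedDeriv k (f ε) (g ε x)) ∈ boundedOn C S := by
  obtain ⟨q, N, c, ε₀, h⟩ := hf.2 k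
  obtain ⟨s, hs, ε₁, h₁⟩ := hg
  refine ⟨(fun _ => |c|) * (fun ε : Idx => (ε : ℝ)⁻¹) ^ N * (1 + s) ^ q,
    C.A.mul_mem (C.A.mul_mem (C.const_mem _) (C.A.pow_mem hinv N))
      (C.A.pow_mem (C.A.add_mem C.A.one_mem hs) q), min ε₀ ε₁, fun ε hε x hx => ?_⟩
  have h₂ := h₁ ε (lt_of_lt_of_le hε (min_le_right _ _)) x hx
  have hε' : (0 : ℝ) < ε := ε.2.1
  refine (h ε (lt_of_lt_of_le hε (min_le_left _ _)) k le_rfl (g ε x)).trans ?_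
  simp only [Pi.mul_apply, Pi.pow_apply, Pi.add_apply, Pi.one_apply, inv_pow]
  gcongr
  exact le_abs_self c

theorem Tempered.mem_derivRing {f : Idx → ℝ → ℝ} (hf : Tempered f) {K : Set ℝ}
    (hK : IsCompact K) : f ∈ derivRing e₁ (boundedOn C fun _ => K) := by
  refine fun n => ⟨fun ε => (hf.1 ε).1, fun w _ => ?_⟩
  obtain ⟨B, hB⟩ := hK.isBounded.exists_norm_le
  simp only [pds_e₁]
  exact hf.iteratedDeriv_comp_mem hinv (g := fun _ x => x)
    ⟨fun _ => B, C.const_mem B, ⟨1, by simp⟩, fun ε _ x hx => hB x hx⟩ _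

theorem Tempered.comp_mem_derivRing {f g : Idx → ℝ → ℝ} (hf : Tempered f) (hg : Tempered g)
    {K : Set ℝ} (hK : IsCompact K) :
    (fun ε x => f ε (g ε x)) ∈ derivRing e₁ (boundedOn C fun _ => K) := by
  intro n
  have hgR := hg.mem_derivRing hinv hK
  have := derivIn_comp e₁ e₁ (G := f) (fun ε => (hf.1 ε).1)
    (Φ := fun _ => g) (R := boundedOn C fun _ => K) (fun _ ε => (hg.1 ε).1) (fun w => ?_) n
    (fun i _ k _ => (hgR (k + 1)).pd i) []
  · simpa [pds, e₁, Pi.smul_def] using this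
  · simpa [pds_e₁, e₁, Pi.smul_def] using hf.iteratedDeriv_comp_mem hinv (hgR 0).mem w.length

end Tempered

/-! ### Symmetry of iterated partial derivatives -/

theorem pd_comm (e : ι → E) (i j : ι) {u : E → ℝ} (hu : ContDiff ℝ ∞ u) :
    pd e i (pd e j u) = pd e j (pd e i u) := by
  funext x
  have hd : DifferentiableAt ℝ (fderiv ℝ u) x :=
    (hu.fderiv_right (m := ∞) (by simp)).differentiable (by simp) x
  have key : ∀ a b : E, fderiv ℝ (fun y => fderiv ℝ u y a) x b = fderiv ℝ (fderiv ℝ u) x b a := by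
    intro a b
    rw [fderiv_clm_apply hd (differentiableAt_const a)]
    simp
  have hs : IsSymmSndFDerivAt ℝ u x := hu.contDiffAt.isSymmSndFDerivAt (by
    simp only [minSmoothness_of_isRCLikeNormedField]
    exact WithTop.coe_le_coe.2 (le_top : (2 : ℕ∞) ≤ ⊤))
  change fderiv ℝ (fun y => fderiv ℝ u y (e j)) x (e i) =
    fderiv ℝ (fun y => fderiv ℝ u y (e i)) x (e j)
  rw [key, key]
  exact hs _ _

theorem pds_perm (e : ι → E) {w w' : List ι} (h : w.Perm w') {u : E → ℝ} (hu : ContDiff ℝ ∞ u) :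
    pds e w u = pds e w' u := by
  induction h with
  | nil => rfl
  | cons i _ ih => rw [pds, pds, ih]
  | swap i j w => exact pd_comm e j i (contDiff_pds e w hu)
  | trans _ _ ih₁ ih₂ => exact ih₁.trans ih₂

theorem pds_append (e : ι → E) (w w' : List ι) (u : E → ℝ) :
    pds e (w ++ w') u = pds e w (pds e w' u) := by
  induction w with
  | nil => rfl
  | cons i w ih => simp only [List.cons_append, pds, ih]

/-- A word in two letters is either mixed, and then `∂²/∂x∂y` can be applied first, or a power of
one letter. -/
theorem perm_append_or_eq_replicate (w : List (Fin 2)) :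
    (∃ w', w.Perm (w' ++ [0, 1])) ∨ ∃ i, w = List.replicate w.length i := by
  by_cases h0 : (0 : Fin 2) ∈ w
  · by_cases h1 : (1 : Fin 2) ∈ w
    · refine Or.inl ⟨(w.erase 0).erase 1, ?_⟩
      have h1' : (1 : Fin 2) ∈ w.erase 0 := (List.mem_erase_of_ne (by decide)).2 h1
      refine (List.perm_cons_erase h0).trans (((List.perm_cons_erase h1').cons 0).trans ?_)
      exact List.perm_append_comm (l₁ := [0, 1])
    · refine Or.inr ⟨0, List.eq_replicate_of_mem fun b hb => ?_⟩
      have : b ≠ 1 := fun h => h1 (h ▸ hb)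
      omega
  · refine Or.inr ⟨1, List.eq_replicate_of_mem fun b hb => ?_⟩
    have : b ≠ 0 := fun h => h0 (h ▸ hb)
    omega

/-! ### Solutions of the hyperbolic equation -/

theorem derivIn_comp₃ {R : Subring (Idx → ℝ × ℝ → ℝ)} {F : ℝ × ℝ × ℝ → ℝ} (hF : ContDiff ℝ ∞ F)
    {u : Idx → ℝ × ℝ → ℝ} (hR : ∀ w : List (Fin 3), (fun ε => comp₃ (pds e₃ w F) (u ε)) ∈ R)
    {n : ℕ} (hu : DerivIn e₂ R n u) : DerivIn e₂ R n (fun ε => comp₃ F (u ε)) := by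
  have hsum : ∀ (v : ℝ × ℝ → ℝ) (p : ℝ × ℝ),
      ∑ j, (![Prod.fst, Prod.snd, v] : Fin 3 → ℝ × ℝ → ℝ) j p • e₃ j = (p.1, p.2, v p) := by
    intro v p
    simp [Fin.sum_univ_three, e₃]
  have := derivIn_comp e₂ e₃ (G := fun _ => F) (fun _ => hF)
    (Φ := fun j ε => (![Prod.fst, Prod.snd, u ε] : Fin 3 → ℝ × ℝ → ℝ) j) (R := R) ?_ ?_ n ?_ []
  · simp only [hsum] at this
    exact this
  · intro j ε
    fin_cases j
    exacts [contDiff_fst, contDiff_snd, hu.1 ε]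
  · simp only [hsum]
    exact hR
  · intro i j k hk
    have h01 : ∀ c : ℝ, c = 0 ∨ c = 1 → DerivIn e₂ R k (fun _ _ => c) := by
      rintro c (rfl | rfl)
      exacts [derivIn_const R.zero_mem, derivIn_const R.one_mem]
    fin_cases j
    · have : pd e₂ i Prod.fst = fun _ => (e₂ i).1 := by
        funext p
        simp [pd, fderiv_fst]
      simpa [this] using h01 (e₂ i).1 (by fin_cases i <;> simp [e₂])
    · have : pd e₂ i Prod.snd = fun _ => (e₂ i).2 := by
        funext p
        simp [pd, fderiv_snd]
      simpa [this] using h01 (e₂ i).2 (by fin_cases i <;> simp [e₂])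
    · exact (hu.mono hk).pd i

section Equation

variable {F : ℝ × ℝ × ℝ → ℝ} {u : Idx → ℝ × ℝ → ℝ} (hu : ∀ ε, ContDiff ℝ ∞ (u ε))
  (heq : ∀ ε, pd e₂ 0 (pd e₂ 1 (u ε)) = comp₃ F (u ε))

include hu heq

theorem pds_of_perm_append {w w' : List (Fin 2)} (h : w.Perm (w' ++ [0, 1])) (ε : Idx) :
    pds e₂ w (u ε) = pds e₂ w' (comp₃ F (u ε)) := by
  rw [pds_perm e₂ h (hu ε), pds_append, ← heq]
  rfl

theorem pd_zero_pds_replicate_one (n : ℕ) (ε : Idx) :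
    pd e₂ 0 (pds e₂ (List.replicate (n + 1) 1) (u ε)) =
      pds e₂ (List.replicate n 1) (comp₃ F (u ε)) := by
  refine pds_of_perm_append (w := 0 :: List.replicate (n + 1) 1) hu heq ?_ ε
  exact (List.perm_append_comm (l₁ := List.replicate n 1) (l₂ := [0, 1])).symm

theorem pd_one_pds_replicate_zero (n : ℕ) (ε : Idx) :
    pd e₂ 1 (pds e₂ (List.replicate (n + 1) 0) (u ε)) =
      pds e₂ (List.replicate n 0) (comp₃ F (u ε)) := by
  refine pds_of_perm_append (w := 1 :: List.replicate (n + 1) 0) hu heq ?_ ε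
  exact (List.Perm.swap 0 1 _).trans
    (List.perm_append_comm (l₁ := List.replicate n 0) (l₂ := [0, 1])).symm

/-- Only the pure derivatives of a solution have to be estimated, since the equation expresses a
mixed derivative of order `n + 1` by derivatives of order less than `n`. -/
theorem derivIn_of_pure {R : Subring (Idx → ℝ × ℝ → ℝ)} (hF : ContDiff ℝ ∞ F) (h₀ : u ∈ R)
    (hR : ∀ w : List (Fin 3), (fun ε => comp₃ (pds e₃ w F) (u ε)) ∈ R)
    (hpure : ∀ n, DerivIn e₂ R n u → DerivIn e₂ R n (fun ε => comp₃ F (u ε)) →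
      ∀ i, (fun ε => pds e₂ (List.replicate (n + 1) i) (u ε)) ∈ R) (n : ℕ) :
    DerivIn e₂ R n u := by
  induction n with
  | zero => exact derivIn_zero.2 ⟨hu, h₀⟩
  | succ n ih =>
    have hc := derivIn_comp₃ hF hR ih
    refine ⟨hu, fun w hw => ?_⟩
    rcases Nat.lt_or_ge n w.length with hn | hn
    · rcases perm_append_or_eq_replicate w with ⟨w', h⟩ | ⟨i, h⟩
      · simp only [pds_of_perm_append hu heq h]
        refine hc.2 w' ?_
        have := h.length_eq
        simp at this
        omega
      · rw [h, show w.length = n + 1 by omega]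
        exact hpure n ih hc i
    · exact ih.2 w hn

end Equation

/-! ### Traces on the curves -/

theorem pd_restr (i : Fin 1) {f : ℝ → ℝ} (hf : ContDiff ℝ ∞ f) {v : ℝ × ℝ → ℝ}
    (hv : ContDiff ℝ ∞ v) :
    pd e₁ i (restr f v) = restr f (pd e₂ 0 v) + deriv f * restr f (pd e₂ 1 v) := by
  have hsum : ∀ x : ℝ, ∑ j, (![fun x => x, f] : Fin 2 → ℝ → ℝ) j x • e₂ j = (x, f x) := by
    intro x
    simp [Fin.sum_univ_two, e₂]
  funext x
  have := pd_comp e₁ e₂ i hv (Φ := ![fun x => x, f]) (by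
    intro j
    fin_cases j
    exacts [contDiff_id, hf]) x
  simp only [hsum] at this
  refine this.trans ?_
  simp [Fin.sum_univ_two, pd_e₁, restr, mul_comm]

/-- The trace of a family on the curves `x = h_ε(y)`, as a function of `y`. -/
def trace (h : Idx → ℝ → ℝ) : (Idx → ℝ × ℝ → ℝ) →+* (Idx → ℝ → ℝ) where
  toFun v := fun ε y => v ε (h ε y, y)
  map_one' := rfl
  map_mul' _ _ := rfl
  map_zero' := rfl
  map_add' _ _ := rfl

theorem trace_apply (h : Idx → ℝ → ℝ) (v : Idx → ℝ × ℝ → ℝ) :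
    trace h v = fun ε y => v ε (h ε y, y) := rfl

theorem pd_trace (i : Fin 1) {h : Idx → ℝ → ℝ} (hh : ∀ ε, ContDiff ℝ ∞ (h ε))
    {v : Idx → ℝ × ℝ → ℝ} (hv : ∀ ε, ContDiff ℝ ∞ (v ε)) :
    (fun ε => pd e₁ i (trace h v ε)) = trace h (fun ε => pd e₂ 0 (v ε)) * (fun ε => deriv (h ε)) +
      trace h (fun ε => pd e₂ 1 (v ε)) := by
  funext ε y
  have hsum : ∀ y : ℝ, ∑ j, (![h ε, fun y => y] : Fin 2 → ℝ → ℝ) j y • e₂ j = (h ε y, y) := by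
    intro x
    simp [Fin.sum_univ_two, e₂]
  have := pd_comp e₁ e₂ i (hv ε) (Φ := ![h ε, fun y => y]) (by
    intro j
    fin_cases j
    exacts [hh ε, contDiff_id]) y
  simp only [hsum] at this
  refine this.trans ?_
  simp [Fin.sum_univ_two, pd_e₁, trace_apply]

/-- The families whose traces on the curves have all their derivatives bounded on `[-b, b]`, for
small `ε`, by elements of the ring of scales. -/
def traceRing (C : Scale) (h : Idx → ℝ → ℝ) (b : ℝ) : Subring (Idx → ℝ × ℝ → ℝ) :=
  (derivRing e₁ (boundedOn C fun _ => Icc (-b) b)).comap (trace h)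

theorem mem_traceRing {C : Scale} {h : Idx → ℝ → ℝ} {b : ℝ} {v : Idx → ℝ × ℝ → ℝ} :
    v ∈ traceRing C h b ↔
      (fun ε y => v ε (h ε y, y)) ∈ derivRing e₁ (boundedOn C fun _ => Icc (-b) b) := Iff.rfl

/-- The box `[f⁻¹(-b), f⁻¹(b)] × [-b, b]`, which the curve `y = f(x)` crosses from corner to
corner. -/
def curveBox (f : ℝ ≃o ℝ) (b : ℝ) : Set (ℝ × ℝ) :=
  Icc (f.symm (-b)) (f.symm b) ×ˢ Icc (-b) b

theorem symm_mem_curveBox {f : ℝ ≃o ℝ} {b y : ℝ} (hy : y ∈ Icc (-b) b) :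
    (f.symm y, y) ∈ curveBox f b :=
  ⟨⟨f.symm.monotone hy.1, f.symm.monotone hy.2⟩, hy⟩

section Curve

variable {C : Scale} {F : ℝ × ℝ × ℝ → ℝ} {f : Idx → ℝ ≃o ℝ} {φ ψ : ℝ → ℝ}
  {u : Idx → ℝ × ℝ → ℝ} {b : ℝ}

theorem IsClassicalSolution.pd_pd {f φ ψ : ℝ → ℝ} {u : ℝ × ℝ → ℝ}
    (h : IsClassicalSolution F f φ ψ u) : pd e₂ 0 (pd e₂ 1 u) = comp₃ F u :=
  funext fun p => h.2.1 p.1 p.2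

/-- Bounds for the traces of the derivatives of `F(·,·,u_ε)`. -/
theorem comp₃_mem_traceRing (hinv : (fun ε : Idx => (ε : ℝ)⁻¹) ∈ C.A) (hF : ContDiff ℝ ∞ F)
    (hFb : ∀ w : List (Fin 3), ∃ t ∈ C.A, ∀ ε, ∀ p ∈ curveBox (f ε) b, ∀ z : ℝ,
      |pds e₃ w F (p.1, p.2, z)| ≤ t ε)
    (hfτ : Tempered fun ε => f ε) (hfτ' : Tempered fun ε => (f ε).symm) (hφ : SlowGrowth φ)
    (hu : ∀ ε, IsClassicalSolution F (f ε) φ ψ (u ε)) (w : List (Fin 3)) :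
    (fun ε => comp₃ (pds e₃ w F) (u ε)) ∈ traceRing C (fun ε => (f ε).symm) b := by
  have hK : IsCompact (Icc (-b) b) := isCompact_Icc
  have hφh := hφ.tempered_const.comp_mem_derivRing hinv hfτ' hK
  -- the identity is `f_ε ∘ f_ε⁻¹`
  have hid : (fun (_ : Idx) (y : ℝ) => y) ∈ derivRing e₁ (boundedOn C fun _ => Icc (-b) b) := by
    simpa using hfτ.comp_mem_derivRing hinv hfτ' hK
  have hval : ∀ ε y, u ε ((f ε).symm y, y) = φ ((f ε).symm y) := fun ε y => by
    simpa using (hu ε).2.2.1 ((f ε).symm y)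
  have hsum : ∀ ε (y : ℝ), ∑ j, (![fun ε => (f ε).symm, fun _ y => y,
      fun ε y => φ ((f ε).symm y)] : Fin 3 → Idx → ℝ → ℝ) j ε y • e₃ j =
        ((f ε).symm y, y, φ ((f ε).symm y)) := by
    intro ε y
    simp [Fin.sum_univ_three, e₃]
  have hΦ : ∀ j, (![fun ε => (f ε).symm, fun _ y => y,
      fun ε y => φ ((f ε).symm y)] : Fin 3 → Idx → ℝ → ℝ) j ∈
        derivRing e₁ (boundedOn C fun _ => Icc (-b) b) := by
    intro j
    fin_cases j
    exacts [hfτ'.mem_derivRing hinv hK, hid, hφh]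
  rw [mem_traceRing]
  simp only [comp₃, hval]
  intro n
  have := derivIn_comp e₁ e₃ (G := fun _ => F) (fun _ => hF) (fun j => (hΦ j 0).1)
    (R := boundedOn C fun _ => Icc (-b) b) ?_ n (fun i j k _ => (hΦ j (k + 1)).pd i) w
  · simp only [hsum] at this
    exact this
  · intro w
    obtain ⟨t, ht, h⟩ := hFb w
    simp only [hsum]
    exact ⟨t, ht, ⟨1, by simp⟩, fun ε _ y hy => h ε _ (symm_mem_curveBox hy) _⟩

/-- All the derivatives of the solutions have good traces: the pure ones are computed by
differentiating the trace of a derivative of lower order along the curve. -/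
theorem derivIn_traceRing (hinv : (fun ε : Idx => (ε : ℝ)⁻¹) ∈ C.A) (hF : ContDiff ℝ ∞ F)
    (hFb : ∀ w : List (Fin 3), ∃ t ∈ C.A, ∀ ε, ∀ p ∈ curveBox (f ε) b, ∀ z : ℝ,
      |pds e₃ w F (p.1, p.2, z)| ≤ t ε)
    (hfτ : Tempered fun ε => f ε) (hfτ' : Tempered fun ε => (f ε).symm) (hφ : SlowGrowth φ)
    (hψ : SlowGrowth ψ) (hu : ∀ ε, IsClassicalSolution F (f ε) φ ψ (u ε)) (n : ℕ) :
    DerivIn e₂ (traceRing C (fun ε => (f ε).symm) b) n u := by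
  have hK : IsCompact (Icc (-b) b) := isCompact_Icc
  have hus : ∀ ε, ContDiff ℝ ∞ (u ε) := fun ε => (hu ε).1
  have heq : ∀ ε, pd e₂ 0 (pd e₂ 1 (u ε)) = comp₃ F (u ε) := fun ε => (hu ε).pd_pd
  have hval : ∀ ε y, u ε ((f ε).symm y, y) = φ ((f ε).symm y) := fun ε y => by
    simpa using (hu ε).2.2.1 ((f ε).symm y)
  have hval' : ∀ ε y, pd e₂ 1 (u ε) ((f ε).symm y, y) = ψ ((f ε).symm y) := fun ε y => by
    simpa using (hu ε).2.2.2 ((f ε).symm y)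
  have h₀ : u ∈ traceRing C (fun ε => (f ε).symm) b := by
    rw [mem_traceRing]
    simp only [hval]
    exact hφ.tempered_const.comp_mem_derivRing hinv hfτ' hK
  have h₁ : (fun ε => pd e₂ 1 (u ε)) ∈ traceRing C (fun ε => (f ε).symm) b := by
    rw [mem_traceRing]
    simp only [hval']
    exact hψ.tempered_const.comp_mem_derivRing hinv hfτ' hK
  have hsymm := hfτ'.mem_derivRing hinv hK
  have hf'h := hfτ.deriv.comp_mem_derivRing hinv hfτ' hK
  refine derivIn_of_pure hus heq hF h₀
    (comp₃_mem_traceRing hinv hF hFb hfτ hfτ' hφ hu) (fun n hn hc i => ?_) n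
  have hs : ∀ (i : Fin 2) ε, ContDiff ℝ ∞ (pds e₂ (List.replicate n i) (u ε)) := fun i ε =>
    contDiff_pds e₂ _ (hus ε)
  have hpd := fun i => pd_trace 0 (h := fun ε => (f ε).symm) (fun ε => (hfτ'.1 ε).1) (hs i)
  have hD := fun i : Fin 2 =>
    pd_mem_derivRing (i := 0) (mem_traceRing.1 (hn.2 (List.replicate n i) (by simp)))
  have hD' : ∀ i : Fin 2, _ ∈ derivRing e₁ (boundedOn C fun _ => Icc (-b) b) :=
    fun i => (hpd i) ▸ (hD i)
  have hderiv : (fun ε => deriv (f ε).symm) ∈ derivRing e₁ (boundedOn C fun _ => Icc (-b) b) := by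
    simpa only [pd_e₁] using pd_mem_derivRing hsymm 0
  fin_cases i
  · have hother : trace (fun ε => (f ε).symm)
        (fun ε => pd e₂ 1 (pds e₂ (List.replicate n 0) (u ε))) ∈
          derivRing e₁ (boundedOn C fun _ => Icc (-b) b) := by
      cases n with
      | zero => exact h₁
      | succ n =>
        simp only [pd_one_pds_replicate_zero hus heq]
        exact hc.2 _ (by simp)
    have key := Subring.mul_mem _ (Subring.sub_mem _ (hD' 0) hother) hf'h
    rw [add_sub_cancel_right] at key
    -- `(f' ∘ f⁻¹) (f⁻¹)' = 1`
    have hone : ∀ ε y, deriv (f ε).symm y * deriv (f ε) ((f ε).symm y) = 1 := by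
      intro ε y
      have h1 := ((hfτ.1 ε).1.differentiable (by simp) ((f ε).symm y)).hasDerivAt
      have h2 := ((hfτ'.1 ε).1.differentiable (by simp) y).hasDerivAt
      have h3 := h1.comp y h2
      have h4 : (f ε) ∘ (f ε).symm = id := by
        funext y
        simp
      rw [h4] at h3
      rw [mul_comm]
      exact h3.unique (hasDerivAt_id y)
    rw [mul_assoc, show ((fun ε => deriv (f ε).symm) * fun ε x => deriv (f ε) ((f ε).symm x)) = 1
      from funext fun ε => funext fun y => hone ε y, mul_one] at key
    exact key
  · cases n with
    | zero => exact h₁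
    | succ n =>
      have hother : trace (fun ε => (f ε).symm)
          (fun ε => pd e₂ 0 (pds e₂ (List.replicate (n + 1) 1) (u ε))) ∈
            derivRing e₁ (boundedOn C fun _ => Icc (-b) b) := by
        simp only [pd_zero_pds_replicate_one hus heq]
        exact hc.2 _ (by simp)
      have key := Subring.sub_mem _ (hD' 1) (Subring.mul_mem _ hother hderiv)
      rw [add_sub_cancel_left] at key
      exact key

end Curve

/-! ### Estimates on the boxes -/

theorem mem_boundedOn_of_traceRing {C : Scale} {h : Idx → ℝ → ℝ} {b : ℝ} {v : Idx → ℝ × ℝ → ℝ}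
    (hv : v ∈ traceRing C h b) :
    (fun ε y => v ε (h ε y, y)) ∈ boundedOn C fun _ => Icc (-b) b :=
  (mem_traceRing.1 hv 0).mem

theorem hasDerivAt_fst {v : ℝ × ℝ → ℝ} (hv : ContDiff ℝ ∞ v) (x y : ℝ) :
    HasDerivAt (fun x => v (x, y)) (pd e₂ 0 v (x, y)) x :=
  ((hv.differentiable (by simp) (x, y)).hasFDerivAt).comp_hasDerivAt x
    ((hasDerivAt_id x).prodMk (hasDerivAt_const x y))

theorem hasDerivAt_snd {v : ℝ × ℝ → ℝ} (hv : ContDiff ℝ ∞ v) (x y : ℝ) :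
    HasDerivAt (fun y => v (x, y)) (pd e₂ 1 v (x, y)) y :=
  ((hv.differentiable (by simp) (x, y)).hasFDerivAt).comp_hasDerivAt y
    ((hasDerivAt_const y x).prodMk (hasDerivAt_id y))

theorem abs_le_of_deriv_le {g g' : ℝ → ℝ} {p q s t c x : ℝ}
    (hg : ∀ x, HasDerivAt g (g' x) x) (ht : ∀ x ∈ Icc p q, |g' x| ≤ t)
    (hc : c ∈ Icc p q) (hs : |g c| ≤ s) (hx : x ∈ Icc p q) : |g x| ≤ s + t * (q - p) := by
  have h1 := (convex_Icc p q).norm_image_sub_le_of_norm_hasDerivWithin_le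
    (fun x _ => (hg x).hasDerivWithinAt) ht hc hx
  simp only [Real.norm_eq_abs] at h1
  have h2 : |x - c| ≤ q - p := abs_sub_le_of_le_of_le hx.1 hx.2 hc.1 hc.2
  have h3 : 0 ≤ t := (abs_nonneg _).trans (ht x hx)
  calc |g x| = |g c + (g x - g c)| := by ring_nf
    _ ≤ |g c| + |g x - g c| := abs_add_le _ _
    _ ≤ s + t * (q - p) := add_le_add hs (h1.trans (mul_le_mul_of_nonneg_left h2 h3))

section Box

variable {C : Scale} {f : Idx → ℝ ≃o ℝ} {b : ℝ} {v : Idx → ℝ × ℝ → ℝ}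

/-- Integration along horizontal lines, starting on the curve. -/
theorem mem_boundedOn_of_pd_zero (hb : 0 ≤ b)
    (hsymm : (fun ε y => (f ε).symm y) ∈ boundedOn C fun _ => Icc (-b) b)
    (hv : ∀ ε, ContDiff ℝ ∞ (v ε))
    (hv₀ : (fun ε y => v ε ((f ε).symm y, y)) ∈ boundedOn C fun _ => Icc (-b) b)
    (hv₁ : (fun ε => pd e₂ 0 (v ε)) ∈ boundedOn C fun ε => curveBox (f ε) b) :
    v ∈ boundedOn C fun ε => curveBox (f ε) b := by
  obtain ⟨w, hw, ε₁, h₁⟩ := hsymm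
  obtain ⟨s, hs, ε₂, h₂⟩ := hv₀
  obtain ⟨t, ht, ε₃, h₃⟩ := hv₁
  refine ⟨s + t * (w + w), C.A.add_mem hs (C.A.mul_mem ht (C.A.add_mem hw hw)),
    min ε₁ (min ε₂ ε₃), ?_⟩
  rintro ε hε ⟨x, y⟩ ⟨hx, hy⟩
  simp only [lt_min_iff] at hε
  have hw' : (f ε).symm b - (f ε).symm (-b) ≤ w ε + w ε := by
    have e1 := (abs_le.1 (h₁ ε hε.1 b ⟨by linarith, le_rfl⟩)).2
    have e2 := (abs_le.1 (h₁ ε hε.1 (-b) ⟨le_rfl, by linarith⟩)).1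
    dsimp only at e1 e2
    linarith
  have ht0 : 0 ≤ t ε := (abs_nonneg _).trans (h₃ ε hε.2.2 (x, y) ⟨hx, hy⟩)
  exact (abs_le_of_deriv_le (fun x => hasDerivAt_fst (hv ε) x y)
    (fun x hx => h₃ ε hε.2.2 (x, y) ⟨hx, hy⟩) (symm_mem_curveBox hy).1 (h₂ ε hε.2.1 y hy) hx).trans
      (add_le_add le_rfl (mul_le_mul_of_nonneg_left hw' ht0))

/-- Integration along vertical lines, starting on the curve. -/
theorem mem_boundedOn_of_pd_one (hv : ∀ ε, ContDiff ℝ ∞ (v ε))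
    (hv₀ : (fun ε y => v ε ((f ε).symm y, y)) ∈ boundedOn C fun _ => Icc (-b) b)
    (hv₁ : (fun ε => pd e₂ 1 (v ε)) ∈ boundedOn C fun ε => curveBox (f ε) b) :
    v ∈ boundedOn C fun ε => curveBox (f ε) b := by
  obtain ⟨s, hs, ε₂, h₂⟩ := hv₀
  obtain ⟨t, ht, ε₃, h₃⟩ := hv₁
  refine ⟨s + t * fun _ => b - -b, C.A.add_mem hs (C.A.mul_mem ht (C.const_mem _)),
    min ε₂ ε₃, ?_⟩
  rintro ε hε ⟨x, y⟩ ⟨hx, hy⟩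
  simp only [lt_min_iff] at hε
  have hfx : f ε x ∈ Icc (-b) b := ⟨(f ε).symm_apply_le.1 hx.1, (f ε).le_symm_apply.1 hx.2⟩
  have h₂' := h₂ ε hε.1 (f ε x) hfx
  simp only [OrderIso.symm_apply_apply] at h₂'
  exact abs_le_of_deriv_le (fun y => hasDerivAt_snd (hv ε) x y)
    (fun y hy => h₃ ε hε.2 (x, y) ⟨hx, hy⟩) hfx h₂' hy

/-- All the derivatives of the solutions are moderate on the boxes. As `F` and its derivatives are
bounded on the boxes uniformly with respect to the last variable, two integrations bound the
solutions themselves, and one integration bounds each pure derivative. -/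
theorem derivIn_boundedOn {F : ℝ × ℝ × ℝ → ℝ} {φ ψ : ℝ → ℝ} {u : Idx → ℝ × ℝ → ℝ}
    (hb : 0 ≤ b) (hinv : (fun ε : Idx => (ε : ℝ)⁻¹) ∈ C.A) (hF : ContDiff ℝ ∞ F)
    (hFb : ∀ w : List (Fin 3), ∃ t ∈ C.A, ∀ ε, ∀ p ∈ curveBox (f ε) b, ∀ z : ℝ,
      |pds e₃ w F (p.1, p.2, z)| ≤ t ε)
    (hfτ : Tempered fun ε => f ε) (hfτ' : Tempered fun ε => (f ε).symm) (hφ : SlowGrowth φ)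
    (hψ : SlowGrowth ψ) (hu : ∀ ε, IsClassicalSolution F (f ε) φ ψ (u ε)) (n : ℕ) :
    DerivIn e₂ (boundedOn C fun ε => curveBox (f ε) b) n u := by
  have hus : ∀ ε, ContDiff ℝ ∞ (u ε) := fun ε => (hu ε).1
  have heq : ∀ ε, pd e₂ 0 (pd e₂ 1 (u ε)) = comp₃ F (u ε) := fun ε => (hu ε).pd_pd
  have hR : ∀ w : List (Fin 3), (fun ε => comp₃ (pds e₃ w F) (u ε)) ∈
      boundedOn C fun ε => curveBox (f ε) b := by
    intro w
    obtain ⟨t, ht, h⟩ := hFb w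
    exact ⟨t, ht, ⟨1, by simp⟩, fun ε _ p hp => h ε p hp _⟩
  have hsymm := (hfτ'.mem_derivRing hinv (isCompact_Icc (a := -b) (b := b)) 0).mem
  have htr := derivIn_traceRing hinv hF hFb hfτ hfτ' hφ hψ hu
  have htr' : ∀ w : List (Fin 2), _ := fun w =>
    mem_boundedOn_of_traceRing ((htr w.length).2 w le_rfl)
  have hus' : ∀ (w : List (Fin 2)) ε, ContDiff ℝ ∞ (pds e₂ w (u ε)) := fun w ε =>
    contDiff_pds e₂ w (hus ε)
  have h₁ : (fun ε => pds e₂ [1] (u ε)) ∈ boundedOn C fun ε => curveBox (f ε) b := by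
    refine mem_boundedOn_of_pd_zero hb hsymm (hus' [1]) (htr' [1]) ?_
    simp only [pds, heq]
    exact hR []
  refine derivIn_of_pure hus heq hF (mem_boundedOn_of_pd_one hus (htr' []) h₁) hR
    (fun n _ hc i => ?_) n
  fin_cases i
  · refine mem_boundedOn_of_pd_one (hus' _) (htr' _) ?_
    simp only [Fin.zero_eta, pd_one_pds_replicate_zero hus heq]
    exact hc.2 _ (by simp)
  · refine mem_boundedOn_of_pd_zero hb hsymm (hus' _) (htr' _) ?_
    simp only [Fin.mk_one, pd_zero_pds_replicate_one hus heq]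
    exact hc.2 _ (by simp)

end Box

/-- Bounds for small `ε` suffice for moderateness, because the ring of scales is overgenerated. -/
theorem seminorm_mem_absA {C : Scale} {p : ℕ} {g : Fin p → Idx → ℝ} (hC : C.OvergeneratedBy g)
    [Finite ι] {e : ι → E}
    {S T : Idx → Set E} (hTS : ∀ ε, T ε ⊆ S ε) {l : ℕ} {v : Idx → E → ℝ}
    (hv : DerivIn e (boundedOn C S) l v) :
    (fun ε => seminorm e (T ε) l (v ε)) ∈ C.absA := by
  have : Fintype {w : List ι // w.length ≤ l} := (List.finite_length_le ι l).fintype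
  choose t ht ε₁ h using fun w : {w : List ι // w.length ≤ l} => hv.2 w.1 w.2
  obtain ⟨ε₀, hε₀⟩ : ∃ ε₀ : Idx, ∀ w, ε₀ ≤ ε₁ w :=
    (Set.finite_range ε₁).bddBelow.imp fun m hm w => hm ⟨w, rfl⟩
  refine (Scale.mem_absA fun _ => seminorm_nonneg ..).2
    (hC.mem_of_eventually_le (t := ∑ w, fun ε => |t w ε|) (C.A.sum_mem fun w _ => ?_) (ε₀ := ε₀)
      fun ε hε => ?_)
  · exact C.solidA _ _ (ht w) fun ε => by simp
  · rw [abs_of_nonneg (seminorm_nonneg ..), Finset.sum_apply]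
    refine seminorm_le (Finset.sum_nonneg fun _ _ => abs_nonneg _) fun w hw x hx => ?_
    refine (h ⟨w, hw⟩ ε (lt_of_lt_of_le hε (hε₀ _)) x (hTS ε hx)).trans ((le_abs_self _).trans ?_)
    exact Finset.single_le_sum (f := fun w => |t w ε|) (fun _ _ => abs_nonneg _)
      (Finset.mem_univ (⟨w, hw⟩ : {w : List ι // w.length ≤ l}))

/-! ### Compatibility with restriction -/

/-- The seminorms of a restriction are controlled, for every `ε`, by those of the function on a
compact set containing the pieces of the curves. -/
theorem exists_seminorm_restr_le {C : Scale} {p : ℕ} {g : Fin p → Idx → ℝ}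
    (hC : C.OvergeneratedBy g) (hinv : (fun ε : Idx => (ε : ℝ)⁻¹) ∈ C.A) {f : Idx → ℝ → ℝ}
    (hf : Tempered f) {K L : Set ℝ} (hK : IsCompact K) (hL : IsCompact L)
    (hKL : ∀ ε, f ε '' K ⊆ L) (l : ℕ) :
    ∃ t ∈ C.A, ∀ ε, 0 ≤ t ε ∧ ∀ v : ℝ × ℝ → ℝ, ContDiff ℝ ∞ v →
      seminorm e₁ K l (restr (f ε) v) ≤ t ε * seminorm e₂ (K ×ˢ L) l v := by
  have hQ : IsCompact (K ×ˢ L) := hK.prod hL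
  have hval : ∀ l ε (v : ℝ × ℝ → ℝ), ContDiff ℝ ∞ v → ∀ x ∈ K,
      |restr (f ε) v x| ≤ seminorm e₂ (K ×ˢ L) l v := fun l ε v hv x hx =>
    le_seminorm e₂ hQ hv (w := []) (by simp) ⟨hx, hKL ε ⟨x, hx, rfl⟩⟩
  have hrs : ∀ ε (v : ℝ × ℝ → ℝ), ContDiff ℝ ∞ v → ContDiff ℝ ∞ (restr (f ε) v) :=
    fun ε v hv => hv.comp (contDiff_id.prodMk (hf.1 ε).1)
  induction l with
  | zero =>
    refine ⟨1, C.A.one_mem, fun ε => ⟨zero_le_one, fun v hv => ?_⟩⟩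
    rw [Pi.one_apply, one_mul]
    refine seminorm_le (seminorm_nonneg ..) fun w hw x hx => ?_
    obtain rfl : w = [] := by simpa using hw
    exact hval 0 ε v hv x hx
  | succ l ih =>
    obtain ⟨t, ht, h⟩ := ih
    have hd := (Scale.mem_absA fun _ => seminorm_nonneg ..).1 (seminorm_mem_absA hC
      (fun _ => subset_rfl) (hf.deriv.mem_derivRing hinv hK l))
    refine ⟨1 + t + (fun _ => 2 ^ l) * ((fun ε => seminorm e₁ K l (deriv (f ε))) * t),
      C.A.add_mem (C.A.add_mem C.A.one_mem ht) (C.A.mul_mem (C.const_mem _)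
        (C.A.mul_mem hd ht)), fun ε => ?_⟩
    obtain ⟨ht0, hv⟩ := h ε
    have hs0 := seminorm_nonneg e₁ K l (deriv (f ε))
    simp only [Pi.add_apply, Pi.mul_apply, Pi.one_apply]
    refine ⟨by positivity, fun v hvs => ?_⟩
    have hn := seminorm_nonneg e₂ (K ×ˢ L) (l + 1) v
    refine seminorm_le (by positivity) fun w hw x hx => ?_
    rcases List.eq_nil_or_concat w with rfl | ⟨w, i, rfl⟩
    · refine (hval (l + 1) ε v hvs x hx).trans (le_mul_of_one_le_left hn ?_)
      have : 0 ≤ 2 ^ l * (seminorm e₁ K l (deriv (f ε)) * t ε) := by positivity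
      linarith
    · rw [List.concat_eq_append] at hw ⊢
      have hp := fun j => contDiff_pd e₂ j hvs
      have hdf : ContDiff ℝ ∞ (deriv (f ε)) := (hf.deriv.1 ε).1
      have hle := fun j : Fin 2 => (hv _ (hp j)).trans
        (mul_le_mul_of_nonneg_left (seminorm_pd_le e₂ hQ l j hvs) ht0)
      rw [pds_append_singleton, pd_restr i (hf.1 ε).1 hvs]
      refine (le_seminorm e₁ hK ((hrs ε _ (hp 0)).add (hdf.mul (hrs ε _ (hp 1)))) (l := l)
        (by simpa using hw) hx).trans ?_
      refine (seminorm_add_le e₁ hK l (hrs ε _ (hp 0)) (hdf.mul (hrs ε _ (hp 1)))).trans ?_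
      have hmul := (seminorm_mul_le e₁ hK l hdf (hrs ε _ (hp 1))).trans
        (mul_le_mul_of_nonneg_left (mul_le_mul_of_nonneg_left (hle 1) hs0) (by positivity))
      refine (add_le_add (hle 0) hmul).trans ?_
      nlinarith

theorem compatibleRestr {C : Scale} {p : ℕ} {g : Fin p → Idx → ℝ}
    (hC : C.OvergeneratedBy g) (hinv : (fun ε : Idx => (ε : ℝ)⁻¹) ∈ C.A) {f : Idx → ℝ → ℝ}
    (hf : Tempered f) (hfc : CBounded f) : CompatibleRestr C f := by
  refine ⟨fun u hu => ⟨fun ε => (hu.1 ε).comp (contDiff_id.prodMk (hf.1 ε).1), fun K hK l => ?_⟩,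
    fun u hu => ⟨fun ε => (hu.1 ε).comp (contDiff_id.prodMk (hf.1 ε).1), fun K hK l => ?_⟩⟩
  all_goals
    obtain ⟨L, hL, hKL⟩ := hfc K hK
    obtain ⟨t, ht, h⟩ := exists_seminorm_restr_le hC hinv hf hK hL hKL l
  · exact Scale.absA_of_le (fun _ => seminorm_nonneg ..)
      (C.A.mul_mem ht (hu.mem (hK.prod hL) l)) fun ε => (h ε).2 _ (hu.1 ε)
  · obtain ⟨hA, hI⟩ := (Scale.mem_absI fun _ => seminorm_nonneg ..).1 (hu.2 _ (hK.prod hL) l)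
    exact Scale.absI_of_le (fun _ => seminorm_nonneg ..) (C.I.mul_mem_left ⟨t, ht⟩ hI)
      fun ε => (h ε).2 _ (hu.1 ε)

/-! ### The geometry of the boxes -/

theorem curveBox_subset_compactK (f : ℝ ≃o ℝ) (A b : ℝ) : curveBox f b ⊆ compactK f A b := by
  rintro ⟨x, y⟩ ⟨hx, hy⟩
  have h1 : f.symm b ≤ betaK f A b := le_max_right _ _
  have h2 : alphaK f A b ≤ f.symm (-b) := min_le_right _ _
  have h3 : widthK f A b / 2 = max (betaK f A b) |alphaK f A b| := by
    rw [widthK]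
    ring
  have h4 := neg_abs_le (alphaK f A b)
  have h5 := le_max_right (betaK f A b) |alphaK f A b|
  refine ⟨?_, hy⟩
  rw [h3]
  exact ⟨by linarith [hx.1], hx.2.trans (h1.trans (le_max_left _ _))⟩

theorem compactL_subset_curveBox {f : ℝ ≃o ℝ} {A B b : ℝ} (hBb : B ≤ b) (h₁ : -b ≤ f (-A))
    (h₂ : f A ≤ b) : compactL f A B ⊆ curveBox f b := by
  rintro ⟨x, y⟩ ⟨hx, hy⟩
  refine ⟨⟨le_trans (le_min ?_ ?_) hx.1, hx.2.trans (max_le ?_ ?_)⟩, by linarith [hy.1],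
    hy.2.trans hBb⟩
  · exact f.symm_apply_le.2 h₁
  · exact f.symm.monotone (by linarith)
  · exact f.le_symm_apply.2 h₂
  · exact f.symm.monotone hBb

theorem Icc_prod_Icc_subset_compactL (f : ℝ ≃o ℝ) (A B : ℝ) :
    Icc (-A) A ×ˢ Icc (-B) B ⊆ compactL f A B :=
  Set.prod_mono (Icc_subset_Icc (min_le_left _ _) (le_max_left _ _)) subset_rfl

/-- By c-boundedness, each of the compact sets `L_ε(A, B)` is contained in a box which the curve
crosses from corner to corner. -/
theorem CBounded.exists_compactL_subset {f : Idx → ℝ ≃o ℝ} (hf : CBounded fun ε => f ε) (A : ℝ)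
    {B : ℝ} (hA : 0 ≤ A) : ∃ b, B ≤ b ∧ ∀ ε, compactL (f ε) A B ⊆ curveBox (f ε) b := by
  obtain ⟨L, hL, h⟩ := hf (Icc (-A) A) isCompact_Icc
  obtain ⟨c, hc⟩ := hL.isBounded.exists_norm_le
  have hfc : ∀ ε, ∀ x ∈ Icc (-A) A, |f ε x| ≤ c := fun ε x hx => hc _ (h ε ⟨x, hx, rfl⟩)
  refine ⟨max B c, le_max_left _ _, fun ε => compactL_subset_curveBox (le_max_left _ _) ?_ ?_⟩
  · have := (abs_le.1 (hfc ε (-A) ⟨le_rfl, by linarith⟩)).1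
    linarith [le_max_right B c]
  · exact (abs_le.1 (hfc ε A ⟨by linarith, le_rfl⟩)).2.trans (le_max_right _ _)

theorem cls_congr [Finite ι] {C : Scale}
    {e : ι → E} {u v : Idx → E → ℝ} (h : u = v) (hu : IsModerate C e u) (hv : IsModerate C e v) :
    cls u hu = cls v hv := by
  subst h
  rfl

end GenFun

end

open GenFun
theorem mainTheorem1
    -- the nonlinearity, the curves `y = f_ε(x)`, the limit curve and the data
    (F : ℝ × ℝ × ℝ → ℝ) (f : Idx → ℝ ≃o ℝ) (f₀ φ ψ : ℝ → ℝ)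
    -- primitives of `ψ ∘ f_ε⁻¹`, the scales, the ring of generalized constants, the solutions
    (χ : Idx → ℝ → ℝ) (M a r : Idx → ℝ) (C : Scale) (u : Idx → ℝ × ℝ → ℝ)
    -- (H)
    (hF : ContDiff ℝ ∞ F)
    (hFz : ∀ K : Set (ℝ × ℝ), IsCompact K → ∃ c : ℝ, ∀ p ∈ K, ∀ z : ℝ,
      |pd e₃ 2 F (p.1, p.2, z)| ≤ c)
    (hf' : ∀ ε x, deriv (f ε) x ≠ 0)
    -- (H1)
    (hM : ∀ ε, 0 < M ε) (ha : ∀ ε, 0 < a ε)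
    (hFM : ∀ A B : ℝ, 0 < A → 0 < B → ∀ l : ℕ, ∃ μ : ℝ, 0 < μ ∧ ∀ ε,
      ∀ p ∈ compactK (f ε) A B, ∀ z : ℝ, ∀ w : List (Fin 3), w.length ≤ l →
        |pds e₃ w F (p.1, p.2, z)| ≤ μ * M ε)
    (hwidth : ∀ A B : ℝ, 0 < A → 0 < B → ∃ ν : ℝ, 0 < ν ∧ ∀ ε, widthK (f ε) A B ≤ ν * a ε)
    -- (H2)
    (hχ : ∀ ε y, HasDerivAt (χ ε) (ψ ((f ε).symm y)) y)
    (hr : ∀ ε, 0 < r ε)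
    (hr' : ∀ K : Set ℝ, IsCompact K → ∀ n : ℕ, ∃ D : Idx → ℝ, (∀ ε, 0 < D ε) ∧ ∃ p : ℕ,
      ∀ ε, ∀ y ∈ K, max |iteratedDeriv n (fun t => φ ((f ε).symm t)) y| |iteratedDeriv n (χ ε) y| ≤
        D ε / r ε ^ p)
    -- (H3)
    (hC : C.OvergeneratedBy ![fun ε => (ε : ℝ), r, M, fun ε => Real.exp (M ε * a ε)])
    -- (H4)
    (hFC : StableUnder C F)
    -- (H5)
    (hf : ∀ ε, ContDiff ℝ ∞ (f ε)) (hφ : SlowGrowth φ) (hψ : SlowGrowth ψ)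
    -- (H6)
    (hfτ : Tempered fun ε => f ε) (hfτ' : Tempered fun ε => (f ε).symm)
    (hfc : CBounded fun ε => f ε) (hf₀ : ConvergesInD (fun ε => f ε) f₀)
    -- the classical solutions of the non-characteristic problems
    (hu : ∀ ε, IsClassicalSolution F (f ε) φ ψ (u ε)) :
    ∃ (hmod : IsModerate C e₂ u) (hcomp : CompatibleRestr C fun ε => f ε),
      (∀ A B : ℝ, 0 < A → 0 < B → ∀ n : ℕ,
        (fun ε => seminorm e₂ (compactL (f ε) A B) n (u ε)) ∈ C.absA) ∧
      IsGenSolution hF hFC hcomp hφ.1 hψ.1 (cls u hmod) := by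
  have hinv : (fun ε : Idx => (ε : ℝ)⁻¹) ∈ C.A := by simpa using hC.inv_gen_mem 0
  have hMA : M ∈ C.A := by simpa using hC.gen_mem 2
  have hcomp : CompatibleRestr C fun ε => f ε := compatibleRestr hC hinv hfτ hfc
  have hbox : ∀ b, 0 < b → ∀ n, DerivIn e₂ (boundedOn C fun ε => curveBox (f ε) b) n u := by
    intro b hb
    refine derivIn_boundedOn hb.le hinv hF (fun w => ?_) hfτ hfτ' hφ hψ hu
    obtain ⟨μ, _, h⟩ := hFM 1 b one_pos hb w.length
    exact ⟨(fun _ => μ) * M, C.A.mul_mem (C.const_mem μ) hMA, fun ε p hp z =>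
      h ε p (curveBox_subset_compactK _ _ _ hp) z w le_rfl⟩
  have hmod : IsModerate C e₂ u := by
    refine ⟨fun ε => (hu ε).1, fun K hK l => ?_⟩
    obtain ⟨c, hc⟩ := hK.isBounded.exists_norm_le
    have hA : 0 < max c 1 := lt_max_of_lt_right one_pos
    obtain ⟨b, hb, hsub⟩ := hfc.exists_compactL_subset (max c 1) (B := max c 1) hA.le
    refine seminorm_mem_absA hC (fun ε => ?_) (hbox b (hA.trans_le hb) l)
    refine Subset.trans (fun p hp => ?_)
      ((Icc_prod_Icc_subset_compactL (f ε) (max c 1) (max c 1)).trans (hsub ε))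
    have h := hc p hp
    exact ⟨abs_le.1 ((norm_fst_le p).trans (h.trans (le_max_left _ _))),
      abs_le.1 ((norm_snd_le p).trans (h.trans (le_max_left _ _)))⟩
  refine ⟨hmod, hcomp, fun A B hA hB n => ?_, ?_, ?_, ?_⟩
  · obtain ⟨b, hb, hsub⟩ := hfc.exists_compactL_subset A (B := B) hA.le
    exact seminorm_mem_absA hC hsub (hbox b (hB.trans_le hb) n)
  · exact cls_congr (funext fun ε => (hu ε).pd_pd) _ _
  · exact cls_congr (funext fun ε => funext (hu ε).2.2.1) _ _
  · exact cls_congr (funext fun ε => funext (hu ε).2.2.2) _ _
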